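/- Let $r$ be a natural number and let $\Gamma$ be a graph without loops; multiple edges are allowed. If $r$ is odd, suppose that each edge of $\Gamma$ is oriented, i.e. its two end vertices are ordered. For a graph $G$ (possibly with loops, with orientations if $r$ is odd) let $\Lambda^r(G)$ be the graded ring generated over $\mathbb Z$ by one generator $e_\beta$ of degree $r-1$ for each edge $\beta$ of $G$, with the relations $e_\beta^2=0$ and $e_\beta e_\gamma=(-1)^{r-1}e_\gamma e_\beta$; so it is the exterior algebra on the edges if $r$ is even, and the commutative polynomial ring on the edges modulo the squares of the generators if $r$ is odd. A circuit $w$ in $G$ consists of edges $w_1,\dots,w_l$ ($l\ge 1$) and vertices $v_1,\dots,v_l,v_{l+1}=v_1$ such that $v_i,v_{i+1}$ are the two ends of $w_i$. Its Arnold class is \[ A(w)=\sum_{i=1}^l(-1)^i e_{w_1}\cdots\widehat{e_{w_i}}\cdots e_{w_l}\ (r\text{ even}),\qquad A(w)=\sum_{i=1}^l\epsilon_i(w)\, e_{w_1}\cdots\widehat{e_{w_i}}\cdots e_{w_l}\ (r\text{ odd}), \] where $\epsilon_i(w)=1$ if $v_i$ is the first vertex of $w_i$ in its orientation and $\epsilon_i(w)=-1$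 otherwise; for a circuit that consists of a single loop, $A(w)=1$. Let $I^r(G)$ be the ideal of $\Lambda^r(G)$ generated by all $A(w)$, let $R^r(G)=\Lambda^r(G)/I^r(G)$, and let $R^r(G)_k$ be its part of degree $k$. For an edge $\alpha$ of $\Gamma$ let $\Gamma\smallsetminus\alpha$ be the graph obtained by deleting $\alpha$, and $\Gamma/\alpha$ the graph obtained from it by identifying the two ends of $\alpha$ (all edges other than $\alpha$ are kept, so edges parallel to $\alpha$ become loops), with the induced orientations. Write $[\beta]$ for the edge of $\Gamma/\alpha$ given by an edge $\beta\ne\alpha$. Then for every edge $\alpha$ of $\Gamma$ there are ring homomorphisms $i_\alpha:R^r(\Gamma\smallsetminus\alpha)\to R^r(\Gamma)$, $e_\beta\mapsto e_\beta$, and $q_\alpha:R^r(\Gamma\smallsetminus\alpha)\to R^r(\Gamma/\alpha)$, $e_\beta\mapsto e_{[\beta]}$, and a homomorphism of abelian groups $g_\alpha:R^r(\Gamma)\to R^r(\Gamma/\alpha)$ with $g_\alpha\big(i_\alpha(x)+i_\alpha(y)e_\alpha\big)=q_\alpha(y)$ for all $x,y\in R^r(\Gamma\smallsetminus\alpha)$,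 and for every integer $k$ the maps $i_\alpha$ and $g_\alpha$ restrict to a short exact sequence of abelian groups \[ 0\to R^r(\Gamma\smallsetminus\alpha)_k\xrightarrow{\,i_\alpha\,} R^r(\Gamma)_k\xrightarrow{\,g_\alpha\,} R^r(\Gamma/\alpha)_{k-r+1}\to 0 . \] -/

import Mathlib

open scoped Graph

noncomputable section

namespace GraphRing

universe u v

/-- The defining relations of the free (strictly) graded commutative `ℤ`-algebra on generators
`e` of degree `r - 1` indexed by `X`, with squares of the generators equal to zero. As `r - 1` and
`r + 1` have the same parity, two generators anticommute for `r` even and commute for `r` odd. -/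
inductive Rel (r : ℕ) (X : Type v) : FreeAlgebra ℤ X → FreeAlgebra ℤ X → Prop
  | sq (a : X) : Rel r X (FreeAlgebra.ι ℤ a * FreeAlgebra.ι ℤ a) 0
  | comm (a b : X) : Rel r X (FreeAlgebra.ι ℤ a * FreeAlgebra.ι ℤ b)
      ((-1) ^ (r + 1) * (FreeAlgebra.ι ℤ b * FreeAlgebra.ι ℤ a))

/-- The algebra `Λ^r` on a set `X` of generators: the exterior algebra over `ℤ` if `r` is even,
the commutative polynomial ring modulo the squares of the generators if `r` is odd. -/
abbrev Lam (r : ℕ) (X : Type v) : Type v := RingQuot (Rel r X)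

/-- The generator `e_a` of `Λ^r`. -/
def Lam.gen (r : ℕ) {X : Type v} (a : X) : Lam r X :=
  RingQuot.mkRingHom (Rel r X) (FreeAlgebra.ι ℤ a)

/-- The product `e_{a₁} ⋯ e_{aₘ}` in `Λ^r` of a list of generators. -/
def Lam.mon (r : ℕ) {X : Type v} (l : List X) : Lam r X := (l.map (Lam.gen r)).prod

/-- The part of `Λ^r` of degree `k`: the span of the products of `m` generators, `m (r - 1) = k`. -/
def Lam.deg (r : ℕ) (X : Type v) (k : ℤ) : AddSubgroup (Lam r X) :=
  AddSubgroup.closure {x | ∃ l : List X, (l.length : ℤ) * ((r : ℤ) - 1) = k ∧ x = Lam.mon r l}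

variable {V : Type u} {E : Type v}

/-- A circuit: edges `w₁, …, wₗ`, `l ≥ 1`, and vertices `v₁, …, vₗ, vₗ₊₁ = v₁` such that `vᵢ` and
`vᵢ₊₁` are the two ends of `wᵢ` (here numbered from `0`; the values of `v` beyond `l` play no
role). -/
structure IsCircuit (Γ : Graph V E) (w : List E(Γ)) (v : ℕ → V) : Prop where
  ne_nil : w ≠ []
  link : ∀ (i : ℕ) (h : i < w.length), Γ.IsLink (w[i] : E) (v i) (v (i + 1))
  closed : v w.length = v 0

/-- An orientation of the edges of `Γ`, given by the first vertex `o e` of each edge `e`. -/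
def IsOrientation (Γ : Graph V E) (o : E → V) : Prop := ∀ e ∈ E(Γ), Γ.Inc e (o e)

open Classical in
/-- The sign of the `i`-th summand of the Arnold class: `(-1)^i` for `r` even, and for `r` odd
`1` or `-1` according to whether the circuit runs through its `i`-th edge along the orientation or
against it. -/
def arnoldSign (r : ℕ) {Γ : Graph V E} (o : E → V) (w : List E(Γ)) (v : ℕ → V)
    (i : Fin w.length) : Lam r E(Γ) :=
  if Even r then (-1) ^ (i : ℕ) else if o (w[i] : E) = v i then 1 else -1

/-- The Arnold class `A(w) = ∑ᵢ ± w₁ ⋯ ŵᵢ ⋯ wₗ` of a circuit. For a loop it is `1`. (Numbering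
the edges from `0` changes it for `r` even at most by an overall sign.) -/
def arnold (r : ℕ) {Γ : Graph V E} (o : E → V) (w : List E(Γ)) (v : ℕ → V) : Lam r E(Γ) :=
  ∑ i : Fin w.length, arnoldSign r o w v i * Lam.mon r (w.eraseIdx i)

/-- The generalized Arnold ideal `I^r(Γ)`. -/
def arnoldIdeal (r : ℕ) (Γ : Graph V E) (o : E → V) : TwoSidedIdeal (Lam r E(Γ)) :=
  TwoSidedIdeal.span {x | ∃ (w : List E(Γ)) (v : ℕ → V), IsCircuit Γ w v ∧ x = arnold r o w v}

/-- The ring `R^r(Γ) = Λ^r(Γ) / I^r(Γ)`. For `r` even it does not depend on `o`. -/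
abbrev R (r : ℕ) (Γ : Graph V E) (o : E → V) : Type v := (arnoldIdeal r Γ o).ringCon.Quotient

/-- The class of the generator `e_a` in `R^r(Γ)`. -/
def gen (r : ℕ) (Γ : Graph V E) (o : E → V) (a : E(Γ)) : R r Γ o :=
  (arnoldIdeal r Γ o).ringCon.mk' (Lam.gen r a)

/-- The part `R^r(Γ)_k` of degree `k`: the image of the part of `Λ^r(Γ)` of degree `k`. -/
def deg (r : ℕ) (Γ : Graph V E) (o : E → V) (k : ℤ) : AddSubgroup (R r Γ o) :=
  (Lam.deg r E(Γ) k).map ((arnoldIdeal r Γ o).ringCon.mk' : Lam r E(Γ) →+ R r Γ o)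

/-- The graph `Γ ∖ α`. -/
abbrev del (Γ : Graph V E) (α : E) : Graph V E := Γ.deleteEdges {α}

/-- The vertices after contraction of `α`: the two ends of `α` are identified. -/
abbrev ContrV (Γ : Graph V E) (α : E) : Type u := Quot (Γ.IsLink α)

/-- The graph `Γ / α`: delete `α` and identify its two ends. All other edges are kept, so that
edges parallel to `α` become loops. -/
abbrev contr (Γ : Graph V E) (α : E) : Graph (ContrV Γ α) E :=
  (del Γ α).map (Quot.mk (Γ.IsLink α))

/-- The orientation of `Γ / α` induced by an orientation of `Γ`. -/
def contrOr (Γ : Graph V E) (α : E) (o : E → V) : E → ContrV Γ α := fun e => Quot.mk _ (o e)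

/-- An edge of `Γ ∖ α` as an edge of `Γ`. -/
def delEdge {Γ : Graph V E} {α : E} (b : E(del Γ α)) : E(Γ) := ⟨b, b.2.1⟩

/-- An edge of `Γ ∖ α` as an edge of `Γ / α`. -/
def contrEdge {Γ : Graph V E} {α : E} (b : E(del Γ α)) : E(contr Γ α) := ⟨b, b.2⟩

end GraphRing

end

/-! All ideals are compared inside one algebra `Λ` on a fixed edge set `X`. For `S ⊆ X` and an
equivalence relation `Q` on the vertices, let `I(S, Q)` (`walkIdeal`) be generated by the Arnold
sums of the walks along `S` that close up modulo `Q`. Deleting `α` removes it from `S`; contracting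
`α` also glues its ends in `Q`. Every `x` in `Λ` is uniquely `x' + x'' e_α` with `x'`, `x''` free of
`e_α`, and `g_α` is induced by the coefficient `x ↦ x''`.

Three facts carry the theorem. `coeff_mem_walkIdeal`: for a non-loop `α` the coefficient maps `I(S,
Q)` to the ideal of the contraction, so `g_α` exists. Erasing the steps along `α` from a closed walk
leaves a closed walk of the contraction, and its Arnold sum and product generate all that can occur.
`exists_sub_mem_walkIdeal`: if the coefficient of `x` lies in the ideal of the contraction, then `x`
is congruent to an element free of `e_α`, which is exactness in the middle. A closed walk of the
contraction is cut where it jumps between the ends of `α`, and the pieces are closed up by `α`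
itself. `mem_walkIdeal_of_ret`: an element of `I(S, Q)` free of `e_α` lies in `I(S \ {α}, Q)`, which
is injectivity of `i_α`. For finite `S` it is proved by induction on the number of edges, together
with a detection principle: without loops and parallel edges, membership in `I(S, Q)` is decided by
the augmentation and by the coefficients at all edges. Parallel edges are removed by substituting
one generator for the other.

Surjectivity holds since `y e_α` maps to `y`. The ideals are homogeneous, so everything restricts to
each degree. -/

noncomputable section

namespace GraphRing

/-! ### The algebra `Λ^r`: substitutions, retractions and the coefficient of a generator -/

section Algebra

variable {r : ℕ} {X Y : Type*}

/-- The sign in the commutation rule `e_a e_b = c e_b e_a`. -/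
def csign (r : ℕ) : ℤ := (-1) ^ (r + 1)

theorem csign_mul_self (r : ℕ) : csign r * csign r = 1 := by
  rw [csign, ← mul_pow]; simp

/-- The algebra `Λ^r`, as a ring with no further structure that unfolds. -/
def Ext (r : ℕ) (X : Type*) : Type _ := Lam r X

instance : Ring (Ext r X) := inferInstanceAs (Ring (Lam r X))

/-- `Ext` is a copy of `Lam`. -/
def Ext.equiv (r : ℕ) (X : Type*) : Lam r X ≃+* Ext r X := RingEquiv.refl _

/-- The generators of `Ext`. -/
def Ext.gen (r : ℕ) {X : Type*} (a : X) : Ext r X := Ext.equiv r X (Lam.gen r a)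

theorem Ext.gen_sq (a : X) : Ext.gen r a * Ext.gen r a = 0 := by
  have := RingQuot.mkRingHom_rel (Rel.sq (r := r) a)
  rw [map_mul, map_zero] at this
  exact this

theorem Ext.gen_comm (a b : X) :
    Ext.gen r a * Ext.gen r b = csign r • (Ext.gen r b * Ext.gen r a) := by
  have := congrArg (Ext.equiv r X) (RingQuot.mkRingHom_rel (Rel.comm (r := r) a b))
  simpa [Ext.gen, Lam.gen, csign, zsmul_eq_mul] using this

/-- The universal property of `Λ^r`. -/
def Ext.lift {B : Type*} [Ring B] (f : X → B) (hsq : ∀ a, f a * f a = 0)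
    (hcomm : ∀ a b, f a * f b = csign r • (f b * f a)) : Ext r X →+* B :=
  (RingQuot.lift ⟨(FreeAlgebra.lift ℤ f : FreeAlgebra ℤ X →ₐ[ℤ] B).toRingHom, by
    intro x y h
    induction h with
    | sq a => simpa using hsq a
    | comm a b => simpa [csign, zsmul_eq_mul] using hcomm a b⟩ :
      Lam r X →+* B).comp (Ext.equiv r X).symm.toRingHom

@[simp] theorem Ext.lift_gen {B : Type*} [Ring B] (f : X → B) (hsq : ∀ a, f a * f a = 0)
    (hcomm : ∀ a b, f a * f b = csign r • (f b * f a)) (a : X) :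
    Ext.lift f hsq hcomm (Ext.gen r a) = f a := by
  have : Ext.lift f hsq hcomm (Ext.gen r a) =
      FreeAlgebra.lift ℤ f (FreeAlgebra.ι ℤ a) := RingQuot.lift_mkRingHom_apply ..
  rw [this, FreeAlgebra.lift_ι_apply]

theorem Ext.induction {P : Ext r X → Prop} (hint : ∀ n : ℤ, P n) (hgen : ∀ a, P (Ext.gen r a))
    (hadd : ∀ x y, P x → P y → P (x + y)) (hmul : ∀ x y, P x → P y → P (x * y)) (x : Ext r X) :
    P x := by
  obtain ⟨y, rfl⟩ := (Ext.equiv r X).surjective x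
  obtain ⟨z, rfl⟩ := RingQuot.mkRingHom_surjective (Rel r X) y
  induction z using FreeAlgebra.induction with
  | grade0 n =>
    have := hint n
    simpa using this
  | grade1 a => exact hgen a
  | mul a b ha hb =>
    rw [map_mul, map_mul]
    exact hmul _ _ ha hb
  | add a b ha hb =>
    rw [map_add, map_add]
    exact hadd _ _ ha hb

theorem Ext.hom_ext {B : Type*} [Ring B] {f g : Ext r X →+* B}
    (h : ∀ a, f (Ext.gen r a) = g (Ext.gen r a)) : f = g := by
  refine RingHom.ext fun x => ?_
  induction x using Ext.induction with
  | hint n => simp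
  | hgen a => exact h a
  | hadd x y hx hy => simp [hx, hy]
  | hmul x y hx hy => simp [hx, hy]

/-- The endomorphism of `Λ^r` rescaling and permuting generators. -/
def Ext.subst (h : X → Y) (k : X → ℤ) : Ext r X →+* Ext r Y :=
  Ext.lift (fun a => k a • Ext.gen r (h a))
    (fun a => by rw [smul_mul_smul_comm, Ext.gen_sq, smul_zero])
    (fun a b => by
      rw [smul_mul_smul_comm, smul_mul_smul_comm, Ext.gen_comm, smul_comm, mul_comm (k a)])

@[simp] theorem Ext.subst_gen (h : X → Y) (k : X → ℤ) (a : X) :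
    Ext.subst (r := r) h k (Ext.gen r a) = k a • Ext.gen r (h a) := Ext.lift_gen ..

/-- Functoriality of `Λ^r`. -/
def Ext.map (h : X → Y) : Ext r X →+* Ext r Y := Ext.subst h 1

@[simp] theorem Ext.map_gen (h : X → Y) (a : X) :
    Ext.map (r := r) h (Ext.gen r a) = Ext.gen r (h a) := by simp [Ext.map]

open Classical in
/-- The retraction of `Λ^r` that kills all generators outside `S`. -/
def Ext.ret (S : Set X) : Ext r X →+* Ext r X := Ext.subst id (fun a => if a ∈ S then 1 else 0)

theorem Ext.ret_gen_mem {S : Set X} {a : X} (h : a ∈ S) :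
    Ext.ret (r := r) S (Ext.gen r a) = Ext.gen r a := by simp [Ext.ret, h]

theorem Ext.ret_gen_notMem {S : Set X} {a : X} (h : a ∉ S) :
    Ext.ret (r := r) S (Ext.gen r a) = 0 := by simp [Ext.ret, h]

theorem Ext.ret_ret (S S' : Set X) (x : Ext r X) :
    Ext.ret S (Ext.ret S' x) = Ext.ret (S ∩ S') x := by
  have : (Ext.ret S).comp (Ext.ret S') = Ext.ret (r := r) (S ∩ S') := by
    apply Ext.hom_ext
    intro a
    by_cases h : a ∈ S <;> by_cases h' : a ∈ S' <;> simp [Ext.ret, h, h']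
  exact congr($this x)

theorem Ext.ret_eq_of_subset {S S' : Set X} (h : S ⊆ S') {x : Ext r X} (hx : Ext.ret S x = x) :
    Ext.ret S' x = x := by
  rw [← hx, Ext.ret_ret, Set.inter_eq_right.2 h]

theorem Ext.ret_univ (x : Ext r X) : Ext.ret Set.univ x = x := by
  have : Ext.ret Set.univ = RingHom.id (Ext r X) :=
    Ext.hom_ext fun a => by simp [Ext.ret]
  exact congr($this x)

theorem Ext.exists_finset_ret (x : Ext r X) : ∃ F : Finset X, Ext.ret (F : Set X) x = x := by
  classical
  induction x using Ext.induction with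
  | hint n => exact ⟨∅, by simp⟩
  | hgen a => exact ⟨{a}, Ext.ret_gen_mem (by simp)⟩
  | hadd x y hx hy =>
    obtain ⟨F, hF⟩ := hx
    obtain ⟨G, hG⟩ := hy
    refine ⟨F ∪ G, ?_⟩
    rw [map_add, Ext.ret_eq_of_subset (by simp) hF, Ext.ret_eq_of_subset (by simp) hG]
  | hmul x y hx hy =>
    obtain ⟨F, hF⟩ := hx
    obtain ⟨G, hG⟩ := hy
    refine ⟨F ∪ G, ?_⟩
    rw [map_mul, Ext.ret_eq_of_subset (by simp) hF, Ext.ret_eq_of_subset (by simp) hG]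

/-- The augmentation of `Λ^r`. -/
def Ext.aug : Ext r X →+* ℤ := Ext.lift 0 (by simp) (by simp)

@[simp] theorem Ext.aug_gen (a : X) : Ext.aug (Ext.gen r a) = 0 := Ext.lift_gen ..

theorem Ext.ret_empty (x : Ext r X) : Ext.ret ∅ x = (Ext.aug x : ℤ) := by
  have : Ext.ret ∅ = (Int.castRingHom (Ext r X)).comp Ext.aug :=
    Ext.hom_ext fun a => by simp [Ext.ret]
  exact congr($this x)

/-- The automorphism of `Λ^r` multiplying each generator with the commutation sign. -/
def Ext.twist : Ext r X →+* Ext r X := Ext.subst id (fun _ => csign r)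

@[simp] theorem Ext.twist_gen (a : X) :
    Ext.twist (Ext.gen r a) = csign r • Ext.gen r a := by simp [Ext.twist]

theorem Ext.twist_ret (S : Set X) (x : Ext r X) :
    Ext.twist (Ext.ret S x) = Ext.ret S (Ext.twist x) := by
  have : Ext.twist.comp (Ext.ret S) = (Ext.ret (r := r) S).comp Ext.twist :=
    Ext.hom_ext fun a => by by_cases h : a ∈ S <;> simp [Ext.ret, h]
  exact congr($this x)

open Classical in
/-- The matrix representation whose upper right entry is the coefficient of `e_a`. -/
def Ext.coeffMatrix (a : X) : Ext r X →+* Matrix (Fin 2) (Fin 2) (Ext r X) :=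
  Ext.lift (fun b => if b = a then !![0, 1; 0, 0] else
      !![Ext.gen r b, 0; 0, csign r • Ext.gen r b])
    (fun b => by
      split_ifs <;> ext i j <;> fin_cases i <;> fin_cases j <;>
        simp [-zsmul_eq_mul, Ext.gen_sq])
    (fun b d => by
      have h := csign_mul_self r
      have h' : Ext.gen r b * Ext.gen r d = csign r • (Ext.gen r d * Ext.gen r b) :=
        Ext.gen_comm b d
      split_ifs <;> ext i j <;> fin_cases i <;> fin_cases j <;>
        simp [-zsmul_eq_mul, smul_smul, h, h'])

/-- The coefficient of `e_a` (on the right), an operator on `Λ^r`. -/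
def Ext.coeff (a : X) : Ext r X →+ Ext r X where
  toFun x := Ext.coeffMatrix a x 0 1
  map_zero' := by simp
  map_add' := by simp

/-- The matrices are upper triangular, so each diagonal entry is itself a ring homomorphism, as
identified in the next two lemmas. -/
theorem Ext.coeffMatrix_lower (a : X) (x : Ext r X) : Ext.coeffMatrix a x 1 0 = 0 := by
  induction x using Ext.induction with
  | hint n => simp [Matrix.intCast_apply]
  | hgen b =>
    simp only [Ext.coeffMatrix, Ext.lift_gen]
    split_ifs <;> simp
  | hadd x y hx hy => simp [hx, hy]
  | hmul x y hx hy => simp [Matrix.mul_apply, hx, hy]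

theorem Ext.coeffMatrix_left (a : X) (x : Ext r X) :
    Ext.coeffMatrix a x 0 0 = Ext.ret {a}ᶜ x := by
  induction x using Ext.induction with
  | hint n => simp [Matrix.intCast_apply]
  | hgen b =>
    simp only [Ext.coeffMatrix, Ext.lift_gen]
    split_ifs with h <;> simp [Ext.ret, h]
  | hadd x y hx hy => simp [hx, hy]
  | hmul x y hx hy => simp [Matrix.mul_apply, hx, hy, Ext.coeffMatrix_lower]

theorem Ext.coeffMatrix_right (a : X) (x : Ext r X) :
    Ext.coeffMatrix a x 1 1 = Ext.twist (Ext.ret {a}ᶜ x) := by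
  induction x using Ext.induction with
  | hint n => simp [Matrix.intCast_apply]
  | hgen b =>
    simp only [Ext.coeffMatrix, Ext.lift_gen]
    split_ifs with h <;> simp [Ext.ret, h]
  | hadd x y hx hy => simp [hx, hy]
  | hmul x y hx hy => simp [Matrix.mul_apply, hx, hy, Ext.coeffMatrix_lower]

/-- A twisted Leibniz rule, read off from the upper right entry of a product of upper triangular
matrices. The twist arises from moving `e_a` past `y` to the right. -/
theorem Ext.coeff_mul (a : X) (x y : Ext r X) : Ext.coeff a (x * y) =
    Ext.ret {a}ᶜ x * Ext.coeff a y + Ext.coeff a x * Ext.twist (Ext.ret {a}ᶜ y) := by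
  rw [← Ext.coeffMatrix_left, ← Ext.coeffMatrix_right]
  simp [Ext.coeff, Matrix.mul_apply]

@[simp] theorem Ext.coeff_gen_self (a : X) : Ext.coeff a (Ext.gen r a) = 1 := by
  simp [Ext.coeff, Ext.coeffMatrix]

theorem Ext.coeff_gen_ne {a b : X} (h : b ≠ a) : Ext.coeff a (Ext.gen r b) = 0 := by
  simp [Ext.coeff, Ext.coeffMatrix, h]

@[simp] theorem Ext.coeff_intCast (a : X) (n : ℤ) : Ext.coeff a (n : Ext r X) = 0 := by
  simp [Ext.coeff, Matrix.intCast_apply]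

@[simp] theorem Ext.coeff_one (a : X) : Ext.coeff a (1 : Ext r X) = 0 := by
  simpa using Ext.coeff_intCast (r := r) a 1

theorem Ext.twist_mul_gen (a : X) (x : Ext r X) :
    Ext.gen r a * x = Ext.twist x * Ext.gen r a := by
  induction x using Ext.induction with
  | hint n => simp [(Int.cast_commute n _).eq]
  | hgen b => rw [Ext.twist_gen, smul_mul_assoc, Ext.gen_comm]
  | hadd x y hx hy => simp [hx, hy, mul_add, add_mul]
  | hmul x y hx hy => rw [← mul_assoc, hx, mul_assoc, hy, map_mul, mul_assoc]

/-- Together with `Ext.ret_compl_coeff` this is the splitting of `Λ` into the part free of `e_a` and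
its right multiple by `e_a`. -/
theorem Ext.eq_ret_add_coeff (a : X) (x : Ext r X) :
    x = Ext.ret {a}ᶜ x + Ext.coeff a x * Ext.gen r a := by
  induction x using Ext.induction with
  | hint n => simp
  | hgen b =>
    by_cases h : b = a
    · subst h; simp [Ext.ret]
    · simp [Ext.ret, h, Ext.coeff_gen_ne h]
  | hadd x y hx hy =>
    conv_lhs => rw [hx, hy]
    simp only [map_add, add_mul]; abel
  | hmul x y hx hy =>
    have h1 : Ext.coeff a x * Ext.gen r a * y =
        Ext.coeff a x * Ext.twist (Ext.ret {a}ᶜ y) * Ext.gen r a := by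
      conv_lhs => rw [hy]
      rw [mul_assoc, mul_add, Ext.twist_mul_gen, ← mul_assoc (Ext.gen r a), Ext.twist_mul_gen,
        mul_assoc (Ext.twist _), Ext.gen_sq, mul_zero, add_zero, mul_assoc]
    conv_lhs => rw [hx, add_mul, h1]
    conv_lhs => enter [1]; rw [hy]
    rw [Ext.coeff_mul, map_mul]
    simp only [mul_add, add_mul, mul_assoc, add_assoc]

theorem Ext.ret_coeff {S : Set X} {a : X} (ha : a ∈ S) (x : Ext r X) :
    Ext.ret S (Ext.coeff a x) = Ext.coeff a (Ext.ret S x) := by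
  induction x using Ext.induction with
  | hint n => simp
  | hgen b =>
    by_cases h : b = a
    · subst h; simp [Ext.ret, ha]
    · by_cases hb : b ∈ S <;> simp [Ext.ret, hb, Ext.coeff_gen_ne h]
  | hadd x y hx hy => simp [hx, hy]
  | hmul x y hx hy =>
    simp only [Ext.coeff_mul, map_add, map_mul, hx, hy, ← Ext.twist_ret, Ext.ret_ret]
    simp only [Set.inter_comm S]

theorem Ext.ret_compl_coeff (a : X) (x : Ext r X) :
    Ext.ret {a}ᶜ (Ext.coeff a x) = Ext.coeff a x := by
  induction x using Ext.induction with
  | hint n => simp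
  | hgen b =>
    by_cases h : b = a
    · subst h; simp
    · simp [Ext.coeff_gen_ne h]
  | hadd x y hx hy => simp [hx, hy]
  | hmul x y hx hy =>
    simp only [Ext.coeff_mul, map_add, map_mul, hx, hy, ← Ext.twist_ret, Ext.ret_ret,
      Set.inter_self]

theorem Ext.coeff_eq_zero {a : X} {x : Ext r X} (h : Ext.ret {a}ᶜ x = x) :
    Ext.coeff a x = 0 := by
  rw [← h]
  clear h
  induction x using Ext.induction with
  | hint n => simp
  | hgen b =>
    by_cases h : b = a
    · subst h; simp [Ext.ret]
    · simp [Ext.ret, h, Ext.coeff_gen_ne h]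
  | hadd x y hx hy => simp [hx, hy]
  | hmul x y hx hy => simp [Ext.coeff_mul, hx, hy]

theorem Ext.ret_diff_coeff {S : Set X} {a : X} (ha : a ∈ S) {x : Ext r X}
    (hx : Ext.ret S x = x) : Ext.ret (S \ {a}) (Ext.coeff a x) = Ext.coeff a x := by
  rw [Set.sdiff_eq, ← Ext.ret_ret, Ext.ret_compl_coeff, Ext.ret_coeff ha, hx]

end Algebra

/-! ### Signed sums with one factor omitted -/

section ArnoldSum

variable {r : ℕ} {X : Type*}

/-- The signed sum of the products of all but one of the members of a list. -/
def arnoldSum {B : Type*} [Ring B] (r : ℕ) : List B → B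
  | [] => 0
  | a :: L => L.prod + csign r • (a * arnoldSum r L)

theorem map_arnoldSum {B C : Type*} [Ring B] [Ring C] (f : B →+* C) (L : List B) :
    f (arnoldSum r L) = arnoldSum r (L.map f) := by
  induction L with
  | nil => simp [arnoldSum]
  | cons a L ih => simp [-zsmul_eq_mul, arnoldSum, ih, map_list_prod]

/-- The omitted factor lies either in `L` or in `M`; in the second case the sign has passed all of
`L`. -/
theorem arnoldSum_append {B : Type*} [Ring B] (L M : List B) : arnoldSum r (L ++ M) =
    arnoldSum r L * M.prod + csign r ^ L.length • (L.prod * arnoldSum r M) := by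
  induction L with
  | nil => simp [arnoldSum]
  | cons a L ih =>
    simp only [List.cons_append, arnoldSum, ih, List.prod_append, List.length_cons,
      List.prod_cons, mul_add, add_mul, smul_add, mul_smul_comm, smul_mul_assoc, mul_assoc,
      pow_succ', mul_smul, add_assoc]

theorem csign_pow_mul_self (r n : ℕ) : csign r ^ n * csign r ^ n = 1 := by
  rw [← mul_pow, csign_mul_self, one_pow]

theorem twist_prod {L : List (Ext r X)} (h : ∀ e ∈ L, Ext.twist e = csign r • e) :
    Ext.twist L.prod = csign r ^ L.length • L.prod := by
  induction L with
  | nil => simp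
  | cons a L ih =>
    rw [List.prod_cons, map_mul, h a (by simp), ih fun e he => h e (by simp [he]),
      smul_mul_smul_comm, List.length_cons, pow_succ']

theorem twist_arnoldSum {L : List (Ext r X)} (h : ∀ e ∈ L, Ext.twist e = csign r • e) :
    Ext.twist (arnoldSum r L) = csign r ^ (L.length + 1) • arnoldSum r L := by
  induction L with
  | nil => simp [arnoldSum]
  | cons a L ih =>
    have hL : ∀ e ∈ L, Ext.twist e = csign r • e := fun e he => h e (by simp [he])
    rw [arnoldSum, map_add, map_zsmul, map_mul, h a (by simp), ih hL, twist_prod hL, smul_add,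
      smul_mul_smul_comm, List.length_cons]
    congr 1
    · rw [pow_succ, pow_succ, mul_assoc, csign_mul_self, mul_one]
    · rw [smul_smul, smul_smul]
      congr 1
      ring

theorem mul_arnoldSum_gen {L : List (Ext r X)} (h : ∀ e ∈ L, Ext.twist e = csign r • e) (a : X) :
    arnoldSum r L * Ext.gen r a =
      csign r ^ (L.length + 1) • (Ext.gen r a * arnoldSum r L) := by
  rw [Ext.twist_mul_gen, twist_arnoldSum h, smul_mul_assoc, smul_smul, csign_pow_mul_self,
    one_smul]

theorem arnoldSum_rotate_one {L : List (Ext r X)} (h : ∀ e ∈ L, Ext.twist e = csign r • e)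
    (k : ℤ) (a : X) : arnoldSum r (L ++ [k • Ext.gen r a]) =
      csign r ^ L.length • arnoldSum r (k • Ext.gen r a :: L) := by
  rw [arnoldSum_append]
  simp only [arnoldSum, List.prod_nil, List.prod_cons, mul_one, mul_zero, smul_zero, add_zero,
    mul_smul_comm, smul_mul_assoc, mul_arnoldSum_gen h, smul_add, smul_smul]
  rw [add_comm]
  congr 2
  ring

end ArnoldSum

/-! ### Walks modulo a vertex relation and their ideals -/

section Walks

variable {r : ℕ} {X Y V W : Type*}

/-- A step along an edge of `S`, forwards or backwards, with the algebra element it stands for. -/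
inductive Step (r : ℕ) (s t : X → V) (S : Set X) : V → V → Ext r X → Prop
  | fwd (b : X) (h : b ∈ S) : Step r s t S (s b) (t b) (Ext.gen r b)
  | bwd (b : X) (h : b ∈ S) : Step r s t S (t b) (s b) (-csign r • Ext.gen r b)

theorem Step.exists_eq {s t : X → V} {S : Set X} {x y : V} {e : Ext r X}
    (h : Step r s t S x y e) : ∃ b ∈ S, ∃ k : ℤ, k * k = 1 ∧ e = k • Ext.gen r b ∧
      ∀ S' : Set X, b ∈ S' → Step r s t S' x y e := by
  cases h with
  | fwd b h => exact ⟨b, h, 1, by simp, by simp, fun S' h' => .fwd b h'⟩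
  | bwd b h => exact ⟨b, h, -csign r, by simp [csign_mul_self], rfl, fun S' h' => .bwd b h'⟩

/-- Walks from `a` to `b` along the edges in `S`, up to the equivalence relation `Q` on the
vertices, given by the list of algebra elements of their steps. -/
inductive Walk (r : ℕ) (s t : X → V) (S : Set X) (Q : Setoid V) : V → V → List (Ext r X) → Prop
  | nil (a b : V) (h : Q a b) : Walk r s t S Q a b []
  | cons (a x y b : V) (e : Ext r X) (L : List (Ext r X)) (h : Q a x) (he : Step r s t S x y e)
      (hL : Walk r s t S Q y b L) : Walk r s t S Q a b (e :: L)

variable {s t : X → V} {S S' : Set X} {Q Q' : Setoid V} {a b d : V} {L M : List (Ext r X)}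

theorem Walk.step_of_mem (h : Walk r s t S Q a b L) {e : Ext r X} (he : e ∈ L) :
    ∃ x y, Step r s t S x y e := by
  induction h with
  | nil a b h => simp at he
  | cons a x y b e' L h he' hL ih =>
    rcases List.mem_cons.1 he with rfl | he
    · exact ⟨x, y, he'⟩
    · exact ih he

theorem Walk.exists_eq (h : Walk r s t S Q a b L) {e : Ext r X} (he : e ∈ L) :
    ∃ b ∈ S, ∃ k : ℤ, k * k = 1 ∧ e = k • Ext.gen r b := by
  obtain ⟨x, y, h⟩ := h.step_of_mem he
  obtain ⟨b, hb, k, hk, he, -⟩ := h.exists_eq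
  exact ⟨b, hb, k, hk, he⟩

theorem Walk.twist (h : Walk r s t S Q a b L) : ∀ e ∈ L, Ext.twist e = csign r • e := by
  intro e he
  obtain ⟨b, -, k, -, rfl⟩ := h.exists_eq he
  rw [map_zsmul, Ext.twist_gen, smul_comm]

theorem Walk.ret (h : Walk r s t S Q a b L) (hS : S ⊆ S') : L.map (Ext.ret S') = L := by
  conv_rhs => rw [← List.map_id L]
  refine List.map_congr_left fun e he => ?_
  obtain ⟨b, hb, k, -, rfl⟩ := h.exists_eq he
  rw [map_zsmul, Ext.ret_gen_mem (hS hb), id]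

theorem Walk.ret_prod (h : Walk r s t S Q a b L) (hS : S ⊆ S') :
    Ext.ret S' L.prod = L.prod := by
  rw [map_list_prod, h.ret hS]

theorem Walk.ret_arnoldSum (h : Walk r s t S Q a b L) (hS : S ⊆ S') :
    Ext.ret S' (arnoldSum r L) = arnoldSum r L := by
  rw [map_arnoldSum, h.ret hS]

theorem Walk.congr_left (h : Walk r s t S Q a b L) (hd : Q d a) : Walk r s t S Q d b L := by
  cases h with
  | nil _ _ h => exact .nil _ _ (Q.trans hd h)
  | cons _ x y _ e L h he hL => exact .cons _ x y _ e L (Q.trans hd h) he hL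

theorem Walk.append (h : Walk r s t S Q a b L) (h' : Walk r s t S Q b d M) :
    Walk r s t S Q a d (L ++ M) := by
  induction h with
  | nil a b h => exact h'.congr_left h
  | cons a x y b e L h he hL ih => exact .cons _ x y _ e _ h he (ih h')

theorem Walk.congr_right (h : Walk r s t S Q a b L) (hd : Q b d) : Walk r s t S Q a d L := by
  simpa using h.append (.nil b d hd)

theorem Step.walk {x y : V} {e : Ext r X} (h : Step r s t S x y e) (Q : Setoid V) :
    Walk r s t S Q x y [e] := .cons _ x y _ e _ (Q.refl x) h (.nil _ _ (Q.refl y))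

theorem Walk.map {s' t' : Y → W} {S' : Set Y} {Q' : Setoid W} (f : Ext r X →+* Ext r Y)
    (p : V → W) (hQ : ∀ x y, Q x y → Q' (p x) (p y))
    (hf : ∀ x y e, Step r s t S x y e →
      ∃ x' y', Q' (p x) x' ∧ Step r s' t' S' x' y' (f e) ∧ Q' y' (p y))
    (h : Walk r s t S Q a b L) : Walk r s' t' S' Q' (p a) (p b) (L.map f) := by
  induction h with
  | nil a b h => exact .nil _ _ (hQ _ _ h)
  | cons a x y b e L h he hL ih =>
    obtain ⟨x', y', h1, h2, h3⟩ := hf _ _ _ he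
    exact .cons _ x' y' _ _ _ (Q'.trans (hQ _ _ h) h1) h2 (ih.congr_left h3)

/-- The (left) ideal generated by the Arnold sums of the closed walks. -/
def walkIdeal (r : ℕ) (s t : X → V) (S : Set X) (Q : Setoid V) : Ideal (Ext r X) :=
  Ideal.span {z | ∃ a L, Walk r s t S Q a a L ∧ z = arnoldSum r L}

theorem Walk.arnoldSum_mem (h : Walk r s t S Q a a L) :
    arnoldSum r L ∈ walkIdeal r s t S Q := Ideal.subset_span ⟨a, L, h, rfl⟩

@[elab_as_elim]
theorem walkIdeal_induction {P : (x : Ext r X) → x ∈ walkIdeal r s t S Q → Prop}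
    (harn : ∀ a L (h : Walk r s t S Q a a L), P (arnoldSum r L) h.arnoldSum_mem)
    (hzero : P 0 (zero_mem _))
    (hadd : ∀ x y hx hy, P x hx → P y hy → P (x + y) (add_mem hx hy))
    (hmul : ∀ x y hy, P y hy → P (x * y) (Ideal.mul_mem_left _ x hy)) {x : Ext r X}
    (hx : x ∈ walkIdeal r s t S Q) : P x hx := by
  refine Submodule.span_induction (p := P) ?_ hzero hadd hmul hx
  rintro _ ⟨a, L, h, rfl⟩
  exact harn a L h

/-- An Arnold sum commutes with each generator up to sign, so the left ideal is two-sided. -/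
theorem walkIdeal_mul_right {x : Ext r X} (hx : x ∈ walkIdeal r s t S Q) (y : Ext r X) :
    x * y ∈ walkIdeal r s t S Q := by
  induction y using Ext.induction generalizing x with
  | hint n =>
    rw [(Int.cast_commute n x).symm.eq]
    exact Ideal.mul_mem_left _ _ hx
  | hgen b =>
    induction hx using walkIdeal_induction with
    | harn a L h =>
      rw [mul_arnoldSum_gen h.twist]
      exact zsmul_mem (Ideal.mul_mem_left _ _ h.arnoldSum_mem) _
    | hzero => simp
    | hadd x y _ _ hx hy => rw [add_mul]; exact add_mem hx hy
    | hmul x y _ hy => rw [mul_assoc]; exact Ideal.mul_mem_left _ _ hy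
  | hadd y z hy hz => rw [mul_add]; exact add_mem (hy hx) (hz hx)
  | hmul y z hy hz => rw [← mul_assoc]; exact hz (hy hx)

theorem walkIdeal_map {s' t' : Y → W} {S' : Set Y} {Q' : Setoid W} (f : Ext r X →+* Ext r Y)
    (p : V → W) (hQ : ∀ x y, Q x y → Q' (p x) (p y))
    (hf : ∀ x y e, Step r s t S x y e →
      ∃ x' y', Q' (p x) x' ∧ Step r s' t' S' x' y' (f e) ∧ Q' y' (p y))
    {x : Ext r X} (hx : x ∈ walkIdeal r s t S Q) : f x ∈ walkIdeal r s' t' S' Q' := by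
  induction hx using walkIdeal_induction with
  | harn a L h =>
    rw [map_arnoldSum]
    exact (h.map f p hQ hf).arnoldSum_mem
  | hzero => simp
  | hadd x y _ _ hx hy => rw [map_add]; exact add_mem hx hy
  | hmul x y _ hy => rw [map_mul]; exact Ideal.mul_mem_left _ _ hy

theorem walkIdeal_mono (hS : S ⊆ S') (hQ : Q ≤ Q') :
    walkIdeal r s t S Q ≤ walkIdeal r s t S' Q' := by
  intro x hx
  refine walkIdeal_map (RingHom.id _) id (fun x y h => hQ h) (fun x y e h => ?_) hx
  obtain ⟨b, hb, -, -, -, h'⟩ := h.exists_eq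
  exact ⟨x, y, Q'.refl _, h' _ (hS hb), Q'.refl _⟩

theorem walkIdeal_twist {x : Ext r X} (hx : x ∈ walkIdeal r s t S Q) :
    Ext.twist x ∈ walkIdeal r s t S Q := by
  induction hx using walkIdeal_induction with
  | harn a L h =>
    rw [twist_arnoldSum h.twist]
    exact zsmul_mem h.arnoldSum_mem _
  | hzero => simp
  | hadd x y _ _ hx hy => rw [map_add]; exact add_mem hx hy
  | hmul x y _ hy => rw [map_mul]; exact Ideal.mul_mem_left _ _ hy

/-- Multiplying the Arnold sum by the first factor kills every summand that still contains it, as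
generators have square zero; what remains is the full product. -/
theorem Walk.prod_mem (h : Walk r s t S Q a a L) (hL : L ≠ []) :
    L.prod ∈ walkIdeal r s t S Q := by
  have hm := h.arnoldSum_mem
  cases h with
  | nil => simp at hL
  | cons _ x y _ e L hx he hL =>
    obtain ⟨b, -, k, -, rfl, -⟩ := he.exists_eq
    have := Ideal.mul_mem_left _ (k • Ext.gen r b) hm
    rwa [arnoldSum, mul_add, mul_smul_comm, ← mul_assoc, smul_mul_smul_comm, Ext.gen_sq,
      smul_zero, zero_mul, smul_zero, add_zero] at this

/-- The equivalence relation obtained from `Q` by identifying `p` and `q`. -/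
def glue (Q : Setoid V) (p q : V) : Setoid V where
  r x y := Q x y ∨ (Q x p ∧ Q q y) ∨ (Q x q ∧ Q p y)
  iseqv := by
    refine ⟨fun x => .inl (Q.refl x), ?_, ?_⟩
    · rintro x y (h | ⟨h, h'⟩ | ⟨h, h'⟩)
      · exact .inl (Q.symm h)
      · exact .inr (.inr ⟨Q.symm h', Q.symm h⟩)
      · exact .inr (.inl ⟨Q.symm h', Q.symm h⟩)
    · rintro x y z (h | ⟨h, h'⟩ | ⟨h, h'⟩) (k | ⟨k, k'⟩ | ⟨k, k'⟩)
      · exact .inl (Q.trans h k)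
      · exact .inr (.inl ⟨Q.trans h k, k'⟩)
      · exact .inr (.inr ⟨Q.trans h k, k'⟩)
      · exact .inr (.inl ⟨h, Q.trans h' k⟩)
      · exact .inl (Q.trans (Q.trans h (Q.symm (Q.trans h' k))) k')
      · exact .inl (Q.trans h k')
      · exact .inr (.inr ⟨h, Q.trans h' k⟩)
      · exact .inl (Q.trans h k')
      · exact .inl (Q.trans (Q.trans h (Q.symm (Q.trans h' k))) k')

theorem le_glue (Q : Setoid V) (p q : V) : Q ≤ glue Q p q := fun _ _ h => .inl h

theorem glue_left_right (Q : Setoid V) (p q : V) : glue Q p q p q :=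
  .inr (.inl ⟨Q.refl _, Q.refl _⟩)

end Walks

/-! ### The coefficient map sends the ideal to that of the contraction -/

section Coefficient

variable {r : ℕ} {X V : Type*} {s t : X → V} {S : Set X} {Q : Setoid V} {a b : V}
  {L : List (Ext r X)} {α : X}

/-- Length one would make `α` a loop. In length two `α` is run through back and forth and the two
terms cancel. From length three on, every summand contains `e_α` twice. -/
theorem Walk.arnoldSum_eq_zero (hα : ¬ Q (s α) (t α)) (h : Walk r s t {α} Q a a L) :
    arnoldSum r L = 0 := by
  have hstep {x y e} (h : Step r s t {α} x y e) :
      (x = s α ∧ y = t α ∧ e = Ext.gen r α) ∨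
        (x = t α ∧ y = s α ∧ e = -csign r • Ext.gen r α) := by
    rcases h with ⟨b, rfl⟩ | ⟨b, rfl⟩ <;> simp
  have hsq {x y e x' y' e'} (h : Step r s t {α} x y e) (h' : Step r s t {α} x' y' e') :
      e * e' = 0 := by
    rcases hstep h with ⟨-, -, rfl⟩ | ⟨-, -, rfl⟩ <;>
      rcases hstep h' with ⟨-, -, rfl⟩ | ⟨-, -, rfl⟩ <;>
      simp only [smul_mul_assoc, mul_smul_comm, Ext.gen_sq, smul_zero]
  cases h with
  | nil => rfl
  | cons _ x y _ e L h he hL =>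
  cases hL with
  | nil _ _ h' =>
    rcases hstep he with ⟨rfl, rfl, -⟩ | ⟨rfl, rfl, -⟩
    · exact absurd (Q.symm (Q.trans h' h)) hα
    · exact absurd (Q.trans h' h) hα
  | cons _ x' y' _ e' L h' he' hL =>
  cases hL with
  | nil _ _ h'' =>
    rcases hstep he with ⟨rfl, rfl, rfl⟩ | ⟨rfl, rfl, rfl⟩ <;>
      rcases hstep he' with ⟨rfl, rfl, rfl⟩ | ⟨rfl, rfl, rfl⟩
    · exact absurd (Q.symm h') hα
    · simp [arnoldSum]
    · simp only [arnoldSum, List.prod_cons, List.prod_nil, mul_one, mul_zero, smul_zero,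
        add_zero, smul_smul, mul_neg, csign_mul_self]
      simp
    · exact absurd h' hα
  | cons _ x'' y'' _ e'' L h'' he'' hL =>
    simp only [arnoldSum, List.prod_cons, mul_add, mul_smul_comm, ← mul_assoc, hsq he' he'',
      hsq he he'', hsq he he', zero_mul, smul_zero, add_zero]

/-- `M` arises from `L` by erasing the steps along `α`. The four formulas are carried together
because prepending a step expresses each of them through the others. -/
theorem Walk.exists_contract (h : Walk r s t S Q a b L) (α : X) :
    ∃ M, Walk r s t (S \ {α}) (glue Q (s α) (t α)) a b M ∧
      (M = [] → Walk r s t {α} Q a b L) ∧ ∃ m n k l : ℤ,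
        Ext.ret {α}ᶜ L.prod = m • M.prod ∧
        Ext.ret {α}ᶜ (arnoldSum r L) = m • arnoldSum r M + n • M.prod ∧
        Ext.coeff α L.prod = k • M.prod ∧
        Ext.coeff α (arnoldSum r L) = k • arnoldSum r M + l • M.prod := by
  induction h with
  | nil a b h =>
    refine ⟨[], .nil _ _ (.inl h), fun _ => .nil _ _ h, 1, 0, 0, 0, ?_⟩
    simp [arnoldSum]
  | cons a x y b e L h he hL ih =>
    obtain ⟨M, hM, hne, m, n, k, l, h1, h2, h3, h4⟩ := ih
    obtain ⟨d, hd, j, hj, rfl, he'⟩ := he.exists_eq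
    by_cases hdα : d = α
    · subst hdα
      have hxy : glue Q (s d) (t d) x y := by
        have h' := he' {d} rfl
        generalize j • Ext.gen r d = e at h'
        rcases h' with ⟨b, rfl⟩ | ⟨b, rfl⟩
        · exact glue_left_right ..
        · exact Setoid.symm' _ (glue_left_right ..)
      refine ⟨M, hM.congr_left (Setoid.trans' _ (le_glue _ _ _ h) hxy),
        fun h0 => .cons _ x y _ _ _ h (he' _ rfl) (hne h0),
        -- Prepending `j e_α`: its multiples vanish under the retraction, so only the summand
        -- omitting it survives there. The coefficient strips `e_α` from the left, which twists
        -- `M.prod` by `csign r ^ M.length` and `arnoldSum r M` by one power more.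
        0, m, j * csign r ^ M.length * m, k + csign r * csign r ^ M.length * j * n, ?_, ?_, ?_, ?_⟩
      · simp [Ext.ret_gen_notMem]
      · simp only [arnoldSum, map_add, map_zsmul, map_mul, h1]
        simp [Ext.ret_gen_notMem]
      · rw [List.prod_cons, Ext.coeff_mul, h1]
        simp only [map_zsmul, Ext.coeff_gen_self, Ext.ret_gen_notMem (S := {d}ᶜ) (a := d) (by simp),
          twist_prod hM.twist, smul_zero, zero_mul, zero_add, smul_mul_assoc, one_mul]
        module
      · simp only [arnoldSum, map_add, map_zsmul, Ext.coeff_mul, h2, h3, Ext.coeff_gen_self,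
          Ext.ret_gen_notMem (S := {d}ᶜ) (a := d) (by simp),
          twist_prod hM.twist, twist_arnoldSum hM.twist,
          zero_mul, zero_add, smul_mul_assoc, one_mul]
        have hc : csign r * csign r ^ (M.length + 1) = csign r ^ M.length := by
          rw [pow_succ', ← mul_assoc, csign_mul_self, one_mul]
        rw [← hc]
        generalize csign r ^ (M.length + 1) = p
        module
    · have hS : d ∈ S \ {α} := ⟨hd, hdα⟩
      have hr : Ext.ret {α}ᶜ (Ext.gen r d) = Ext.gen r d := Ext.ret_gen_mem (by simpa using hdα)
      refine ⟨_, .cons _ x y _ _ _ (le_glue _ _ _ h) (he' _ hS) hM, by simp, m, csign r * n,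
        k, csign r * l, ?_, ?_, ?_, ?_⟩
      · rw [List.prod_cons, List.prod_cons, map_mul, h1, map_zsmul, hr, mul_smul_comm]
      · simp only [arnoldSum, map_add, map_zsmul, map_mul, h1, h2, hr, mul_add, mul_smul_comm,
          smul_mul_assoc, List.prod_cons]
        module
      · simp only [List.prod_cons, Ext.coeff_mul, h3, map_zsmul, hr, Ext.coeff_gen_ne hdα,
          smul_zero, zero_mul, add_zero, mul_smul_comm]
      · simp only [arnoldSum, map_add, map_zsmul, Ext.coeff_mul, h3, h4, hr,
          Ext.coeff_gen_ne hdα, zero_mul, add_zero, mul_add, mul_smul_comm,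
          smul_mul_assoc, List.prod_cons]
        module

theorem coeff_mem_walkIdeal (hα : ¬ Q (s α) (t α)) {x : Ext r X}
    (hx : x ∈ walkIdeal r s t S Q) :
    Ext.coeff α x ∈ walkIdeal r s t (S \ {α}) (glue Q (s α) (t α)) := by
  -- The Leibniz rule for the coefficient involves the retraction, so both memberships are proved
  -- simultaneously.
  suffices Ext.ret {α}ᶜ x ∈ walkIdeal r s t (S \ {α}) (glue Q (s α) (t α)) ∧
      Ext.coeff α x ∈ walkIdeal r s t (S \ {α}) (glue Q (s α) (t α)) from this.2
  induction hx using walkIdeal_induction with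
  | harn a L h =>
    obtain ⟨M, hM, hne, m, n, k, l, -, h2, -, h4⟩ := h.exists_contract α
    by_cases h0 : M = []
    · simp [(hne h0).arnoldSum_eq_zero hα]
    · rw [h2, h4]
      exact ⟨add_mem (zsmul_mem hM.arnoldSum_mem _) (zsmul_mem (hM.prod_mem h0) _),
        add_mem (zsmul_mem hM.arnoldSum_mem _) (zsmul_mem (hM.prod_mem h0) _)⟩
  | hzero => simp
  | hadd x y _ _ hx hy =>
    rw [map_add, map_add]
    exact ⟨add_mem hx.1 hy.1, add_mem hx.2 hy.2⟩
  | hmul x y _ hy =>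
    rw [map_mul, Ext.coeff_mul]
    exact ⟨Ideal.mul_mem_left _ _ hy.1, add_mem (Ideal.mul_mem_left _ _ hy.2)
      (Ideal.mul_mem_left _ _ (walkIdeal_twist hy.1))⟩

end Coefficient

/-! ### Eliminating a generator whose coefficient vanishes in the contraction -/

section Lifting

variable {r : ℕ} {X V : Type*} {s t : X → V} {S : Set X} {Q : Setoid V} {a b : V}
  {L : List (Ext r X)} {α : X}

theorem Ext.twist_twist (x : Ext r X) : Ext.twist (Ext.twist x) = x := by
  have : (Ext.twist (r := r) (X := X)).comp Ext.twist = RingHom.id _ :=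
    Ext.hom_ext fun a => by
      rw [RingHom.comp_apply, Ext.twist_gen, map_zsmul, Ext.twist_gen, smul_smul,
        csign_mul_self, one_smul, RingHom.id_apply]
  exact congr($this x)

theorem arnoldSum_rotate (M N : List (Ext r X))
    (h : ∀ e ∈ M ++ N, ∃ (b : X) (k : ℤ), e = k • Ext.gen r b) :
    ∃ k : ℤ, arnoldSum r (M ++ N) = k • arnoldSum r (N ++ M) := by
  induction M generalizing N with
  | nil => exact ⟨1, by simp⟩
  | cons a M ih =>
    obtain ⟨b, j, rfl⟩ := h a (by simp)
    have ht : ∀ e ∈ M ++ N, Ext.twist e = csign r • e := by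
      intro e he
      obtain ⟨b, k, rfl⟩ := h e (by simp at he ⊢; tauto)
      rw [map_zsmul, Ext.twist_gen, smul_comm]
    obtain ⟨k, hk⟩ := ih (N ++ [j • Ext.gen r b]) (fun e he => h e (by simp at he ⊢; tauto))
    have h1 := arnoldSum_rotate_one ht j b
    refine ⟨csign r ^ (M ++ N).length * k, ?_⟩
    have h2 := congrArg (csign r ^ (M ++ N).length • ·) h1
    simp only [smul_smul, csign_pow_mul_self, one_smul] at h2
    rw [List.cons_append, ← h2, List.append_assoc, hk, smul_smul]
    simp

/-- `y e_α` lies in the subalgebra of `S ∖ α`, modulo the ideal of `S`. -/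
def Liftable (s t : X → V) (S : Set X) (Q : Setoid V) (α : X) (y : Ext r X) : Prop :=
  ∃ x, Ext.ret (S \ {α}) x = x ∧ y * Ext.gen r α - x ∈ walkIdeal r s t S Q

theorem Liftable.of_mem {y : Ext r X} (h : y ∈ walkIdeal r s t S Q) :
    Liftable s t S Q α y := ⟨0, by simp, by simpa using walkIdeal_mul_right h _⟩

theorem Liftable.add {y z : Ext r X} (hy : Liftable s t S Q α y) (hz : Liftable s t S Q α z) :
    Liftable s t S Q α (y + z) := by
  obtain ⟨x, hx, hx'⟩ := hy
  obtain ⟨w, hw, hw'⟩ := hz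
  refine ⟨x + w, by rw [map_add, hx, hw], ?_⟩
  rw [add_mul, add_sub_add_comm]
  exact add_mem hx' hw'

theorem Liftable.mul_left {y z : Ext r X} (hy : Liftable s t S Q α y)
    (hz : Ext.ret (S \ {α}) z = z) : Liftable s t S Q α (z * y) := by
  obtain ⟨x, hx, hx'⟩ := hy
  refine ⟨z * x, by rw [map_mul, hx, hz], ?_⟩
  rw [mul_assoc, ← mul_sub]
  exact Ideal.mul_mem_left _ _ hx'

theorem Liftable.zsmul {y : Ext r X} (hy : Liftable s t S Q α y) (k : ℤ) :
    Liftable s t S Q α (k • y) := by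
  rw [zsmul_eq_mul]
  exact hy.mul_left (map_intCast _ _)

theorem Liftable.mul_right {y z : Ext r X} (hy : Liftable s t S Q α y)
    (hz : Ext.ret (S \ {α}) z = z) : Liftable s t S Q α (y * z) := by
  obtain ⟨x, hx, hx'⟩ := hy
  refine ⟨x * Ext.twist z, by rw [map_mul, hx, ← Ext.twist_ret, hz], ?_⟩
  have : y * z * Ext.gen r α = y * Ext.gen r α * Ext.twist z := by
    rw [mul_assoc, mul_assoc, Ext.twist_mul_gen, Ext.twist_twist]
  rw [this, ← sub_mul]
  exact walkIdeal_mul_right hx' _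

theorem Walk.mono {S' : Set X} {Q' : Setoid V} (h : Walk r s t S Q a b L) (hS : S ⊆ S')
    (hQ : Q ≤ Q') : Walk r s t S' Q' a b L := by
  have := h.map (s' := s) (t' := t) (S' := S') (Q' := Q') (RingHom.id _) id
    (fun x y h => hQ h) (fun x y e h => by
      obtain ⟨b, hb, -, -, -, h'⟩ := h.exists_eq
      exact ⟨x, y, Q'.refl _, h' _ (hS hb), Q'.refl _⟩)
  simpa using this

/-- The step along `α` closes the walk. The Arnold sum of the closed walk is, up to signs,
`arnoldSum r L * e_α` plus the product of `L`, and the latter is free of `e_α`. -/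
theorem Walk.liftable_of_step (h : Walk r s t (S \ {α}) Q a b L) {x y : V}
    {k : ℤ} (hk : k * k = 1) (he : Step r s t S x y (k • Ext.gen r α)) (hb : Q b x)
    (ha : Q y a) : Liftable s t S Q α (arnoldSum r L) := by
  have hw : Walk r s t S Q a a (L ++ [k • Ext.gen r α]) :=
    ((h.mono Set.sdiff_subset le_rfl).congr_right hb).append ((he.walk Q).congr_right ha)
  refine ⟨-(k * csign r ^ L.length) • L.prod, by rw [map_zsmul, h.ret_prod subset_rfl], ?_⟩
  have := zsmul_mem hw.arnoldSum_mem k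
  rw [arnoldSum_append] at this
  simp only [arnoldSum, List.prod_cons, List.prod_nil, mul_one, mul_zero, smul_zero, add_zero,
    mul_smul_comm, smul_add, smul_smul, hk, one_smul] at this
  rwa [neg_smul, sub_neg_eq_add]

/-- Either the walk starts and finishes at the same end of `α`, and its Arnold sum is already in the
ideal, or `α` closes it. -/
theorem Walk.liftable (hα : α ∈ S) (h : Walk r s t (S \ {α}) Q a b L)
    (ha : Q a (s α) ∨ Q a (t α)) (hb : Q b (s α) ∨ Q b (t α)) :
    Liftable s t S Q α (arnoldSum r L) := by
  have hclosed (hab : Q b a) : Liftable s t S Q α (arnoldSum r L) :=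
    .of_mem ((h.congr_right hab).mono Set.sdiff_subset le_rfl).arnoldSum_mem
  rcases ha with ha | ha <;> rcases hb with hb | hb
  · exact hclosed (Q.trans hb (Q.symm ha))
  · exact h.liftable_of_step (by simp [csign_mul_self]) (.bwd α hα) hb (Q.symm ha)
  · refine h.liftable_of_step (k := 1) (by simp) ?_ hb (Q.symm ha)
    rw [one_smul]
    exact .fwd α hα
  · exact hclosed (Q.trans hb (Q.symm ha))

theorem glue_cases {Q : Setoid V} {p q x y : V} (h : glue Q p q x y) :
    Q x y ∨ (Q x p ∨ Q x q) ∧ (Q y p ∨ Q y q) := by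
  rcases h with h | ⟨h, h'⟩ | ⟨h, h'⟩
  · exact .inl h
  · exact .inr ⟨.inl h, .inr (Q.symm h')⟩
  · exact .inr ⟨.inr h, .inl (Q.symm h')⟩

/-- A walk in the contraction is cut where it jumps between the ends of `α`. `L₁` precedes the first
jump, `L₃` follows the last, and the stretches between jumps join ends of `α`, so their
concatenation `L₂` is liftable by the product rule for Arnold sums. -/
theorem Walk.decompose (hα : α ∈ S) (h : Walk r s t (S \ {α}) (glue Q (s α) (t α)) a b L) :
    Walk r s t (S \ {α}) Q a b L ∨ ∃ L₁ L₂ L₃ x y, L = L₁ ++ L₂ ++ L₃ ∧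
      Walk r s t (S \ {α}) Q a x L₁ ∧ (Q x (s α) ∨ Q x (t α)) ∧
      Ext.ret (S \ {α}) L₂.prod = L₂.prod ∧ Liftable s t S Q α (arnoldSum r L₂) ∧
      (Q y (s α) ∨ Q y (t α)) ∧ Walk r s t (S \ {α}) Q y b L₃ := by
  have hnil : Liftable s t S Q α (arnoldSum r ([] : List (Ext r X))) := .of_mem (zero_mem _)
  induction h with
  | nil a b h =>
    rcases glue_cases h with h | ⟨h, h'⟩
    · exact .inl (.nil _ _ h)
    · exact .inr ⟨[], [], [], a, b, rfl, .nil _ _ (Q.refl a), h, by simp, hnil, h',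
        .nil _ _ (Q.refl b)⟩
  | cons a x y b e L h he hL ih =>
    rcases ih with ih | ⟨L₁, L₂, L₃, x', y', rfl, h1, hx', h2, h2', hy', h3⟩
    · rcases glue_cases h with h | ⟨h, h'⟩
      · exact .inl (.cons _ _ _ _ _ _ h he ih)
      · exact .inr ⟨[], [], e :: L, a, x, rfl, .nil _ _ (Q.refl a), h, by simp, hnil, h',
          .cons _ _ _ _ _ _ (Q.refl x) he ih⟩
    · rcases glue_cases h with h | ⟨h, h'⟩
      · exact .inr ⟨e :: L₁, L₂, L₃, x', y', rfl, .cons _ _ _ _ _ _ h he h1, hx', h2, h2', hy',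
          h3⟩
      · have hw : Walk r s t (S \ {α}) Q x x' (e :: L₁) := .cons _ _ _ _ _ _ (Q.refl x) he h1
        refine .inr ⟨[], e :: L₁ ++ L₂, L₃, a, y', rfl, .nil _ _ (Q.refl a), h, ?_, ?_, hy', h3⟩
        · rw [List.prod_append, map_mul, h2, hw.ret_prod subset_rfl]
        · rw [arnoldSum_append]
          exact ((hw.liftable hα h' hx').mul_right h2).add
            ((h2'.mul_left (hw.ret_prod subset_rfl)).zsmul _)

/-- Since the walk is closed in the contraction, rotating it joins the outer pieces `L₃` and `L₁` to
one walk between ends of `α`. -/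
theorem Walk.liftable_of_glue (hα : α ∈ S)
    (h : Walk r s t (S \ {α}) (glue Q (s α) (t α)) a a L) :
    Liftable s t S Q α (arnoldSum r L) := by
  rcases h.decompose hα with h' | ⟨L₁, L₂, L₃, x, y, rfl, h1, hx, h2, h2', hy, h3⟩
  · exact .of_mem (h'.mono Set.sdiff_subset le_rfl).arnoldSum_mem
  · obtain ⟨k, hk⟩ := arnoldSum_rotate (L₁ ++ L₂) L₃ (fun e he => by
      obtain ⟨b, -, k, -, h⟩ := h.exists_eq he
      exact ⟨b, k, h⟩)
    have hw := h3.append h1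
    rw [hk, ← List.append_assoc, arnoldSum_append]
    exact (((hw.liftable hα hy hx).mul_right h2).add
      ((h2'.mul_left (hw.ret_prod subset_rfl)).zsmul _)).zsmul _

theorem exists_sub_mem_walkIdeal (hα : α ∈ S) {x : Ext r X} (hx : Ext.ret S x = x)
    (h : Ext.coeff α x ∈ walkIdeal r s t (S \ {α}) (glue Q (s α) (t α))) :
    ∃ y, Ext.ret (S \ {α}) y = y ∧ x - y ∈ walkIdeal r s t S Q := by
  -- The retraction is inserted because multipliers occurring in an element of the ideal may involve
  -- `e_α`, whereas `Liftable.mul_left` needs them free of it.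
  have key {y : Ext r X} (hy : y ∈ walkIdeal r s t (S \ {α}) (glue Q (s α) (t α))) :
      Liftable s t S Q α (Ext.ret (S \ {α}) y) := by
    induction hy using walkIdeal_induction with
    | harn a L h =>
      rw [h.ret_arnoldSum subset_rfl]
      exact h.liftable_of_glue hα
    | hzero => rw [map_zero]; exact .of_mem (zero_mem _)
    | hadd x y _ _ hx hy => rw [map_add]; exact hx.add hy
    | hmul x y _ hy =>
      rw [map_mul]
      exact hy.mul_left (by rw [Ext.ret_ret, Set.inter_self])
  obtain ⟨y, hy, hy'⟩ := key h
  rw [Ext.ret_diff_coeff hα hx] at hy'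
  refine ⟨Ext.ret {α}ᶜ x + y, ?_, ?_⟩
  · have : Ext.ret {α}ᶜ x = Ext.ret (S \ {α}) x := by
      conv_lhs => rw [← hx, Ext.ret_ret, Set.inter_comm, ← Set.sdiff_eq]
    rw [map_add, hy, this, Ext.ret_ret, Set.inter_self]
  · have := Ext.eq_ret_add_coeff α x
    rwa [← add_sub_add_left_eq_sub _ _ (Ext.ret {α}ᶜ x), ← this] at hy'

end Lifting

/-! ### Injectivity of the deletion map -/

section Injectivity

variable {r : ℕ} {X V : Type*} {s t : X → V} {S : Set X} {Q : Setoid V} {α : X}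

/-- No edge in `S` is a loop. -/
def LooplessOn (s t : X → V) (S : Set X) (Q : Setoid V) : Prop := ∀ b ∈ S, ¬ Q (s b) (t b)

/-- The two edges have the same ends. -/
def Parallel (s t : X → V) (Q : Setoid V) (b d : X) : Prop :=
  (Q (s b) (s d) ∧ Q (t b) (t d)) ∨ (Q (s b) (t d) ∧ Q (t b) (s d))

theorem Parallel.symm {b d : X} (h : Parallel s t Q b d) : Parallel s t Q d b := by
  rcases h with ⟨h, h'⟩ | ⟨h, h'⟩
  · exact .inl ⟨Q.symm h, Q.symm h'⟩
  · exact .inr ⟨Q.symm h', Q.symm h⟩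

theorem LooplessOn.mono {S' : Set X} (h : LooplessOn s t S Q) (hS : S' ⊆ S) :
    LooplessOn s t S' Q := fun b hb => h b (hS hb)

/-- Contracting `b` can turn only edges parallel to `b` into loops. -/
theorem LooplessOn.contract (h : LooplessOn s t S Q) {b : X}
    (hp : ∀ d ∈ S, b ≠ d → ¬ Parallel s t Q b d) :
    LooplessOn s t (S \ {b}) (glue Q (s b) (t b)) := by
  rintro d ⟨hd, hdb⟩ (hQ | ⟨h1, h2⟩ | ⟨h1, h2⟩)
  · exact h d hd hQ
  · exact hp d hd (Ne.symm hdb) (.inl ⟨Q.symm h1, h2⟩)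
  · exact hp d hd (Ne.symm hdb) (.inr ⟨h2, Q.symm h1⟩)

/-- Only a closed walk of length one has a constant term in its Arnold sum, and it would be a loop.
-/
theorem LooplessOn.aug_eq_zero (h : LooplessOn s t S Q) {x : Ext r X}
    (hx : x ∈ walkIdeal r s t S Q) : Ext.aug x = 0 := by
  induction hx using walkIdeal_induction with
  | harn a L hL =>
    have haug {x y e} (he : Step r s t S x y e) : Ext.aug e = 0 := by
      obtain ⟨b, -, k, -, rfl, -⟩ := he.exists_eq
      rw [map_zsmul, Ext.aug_gen, smul_zero]
    cases hL with
    | nil => simp [arnoldSum]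
    | cons _ x y _ e L h1 he hL =>
    cases hL with
    | nil _ _ h2 =>
      cases he with
      | fwd b hb => exact absurd (Q.symm (Q.trans h2 h1)) (h b hb)
      | bwd b hb => exact absurd (Q.trans h2 h1) (h b hb)
    | cons _ x' y' _ e' L h2 he' hL =>
      simp only [arnoldSum, List.prod_cons, map_add, map_zsmul, map_mul, haug he, haug he',
        zero_mul, smul_zero, add_zero]
  | hzero => simp
  | hadd x y _ _ hx hy => rw [map_add, hx, hy, add_zero]
  | hmul x y _ hy => rw [map_mul, hy, mul_zero]

/-- The homomorphism replaces `e_b` by `± e_d`. It respects walks because `d` can be used in place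
of `b`, and it is the identity modulo the ideal because of the circuit formed by `b` and `d`. -/
theorem Parallel.exists_subst (r : ℕ) {b d : X} (h : Parallel s t Q b d) (hbd : b ≠ d) :
    ∃ f : Ext r X →+* Ext r X,
      (∀ S : Set X, d ∈ S → ∀ x ∈ walkIdeal r s t S Q, f x ∈ walkIdeal r s t (S \ {b}) Q) ∧
      (∀ S : Set X, b ∈ S → d ∈ S → ∀ x, x - f x ∈ walkIdeal r s t S Q) ∧
      (∀ S : Set X, d ∈ S → ∀ x, Ext.ret S x = x → Ext.ret (S \ {b}) (f x) = f x) ∧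
      (∀ x, Ext.ret {b}ᶜ x = x → f x = x) := by
  classical
  -- `k` is the sign for which `k e_d` is the step along `d` in the direction of `b`; the reverse
  -- step then carries the additional factor `-csign r`.
  obtain ⟨k, hk, hstep, hwalk⟩ : ∃ k : ℤ, k * k = 1 ∧ (∀ S : Set X, d ∈ S →
      ∃ x y, Q (s b) x ∧ Step r s t S x y (k • Ext.gen r d) ∧ Q y (t b)) ∧
      (∀ S : Set X, d ∈ S →
      ∃ x y, Q (t b) x ∧ Step r s t S x y ((-csign r * k) • Ext.gen r d) ∧ Q y (s b)) := by
    rcases h with ⟨h1, h2⟩ | ⟨h1, h2⟩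
    · refine ⟨1, by simp, fun S hS => ⟨_, _, h1, ?_, Q.symm h2⟩,
        fun S hS => ⟨_, _, h2, ?_, Q.symm h1⟩⟩
      · rw [one_smul]; exact .fwd d hS
      · rw [mul_one]; exact .bwd d hS
    · refine ⟨-csign r, by simp [csign_mul_self], fun S hS => ⟨_, _, h1, .bwd d hS, Q.symm h2⟩,
        fun S hS => ⟨_, _, h2, ?_, Q.symm h1⟩⟩
      rw [neg_mul_neg, csign_mul_self, one_smul]
      exact .fwd d hS
  let f : Ext r X →+* Ext r X :=
    Ext.subst (fun x => if x = b then d else x) (fun x => if x = b then k else 1)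
  have hfb : f (Ext.gen r b) = k • Ext.gen r d := by simp [f]
  have hf {x : X} (hx : x ≠ b) : f (Ext.gen r x) = Ext.gen r x := by simp [f, hx]
  refine ⟨f, fun S hd x hx => ?_, fun S hb hd x => ?_, fun S hd x hx => ?_, fun x hx => ?_⟩
  · refine walkIdeal_map f id (fun _ _ h => h) (fun x y e he => ?_) hx
    have hd' : d ∈ S \ {b} := ⟨hd, hbd.symm⟩
    cases he with
    | fwd z hz =>
      by_cases hzb : z = b
      · subst hzb
        rw [hfb]
        exact hstep _ hd'
      · rw [hf hzb]
        exact ⟨_, _, Q.refl _, .fwd z ⟨hz, hzb⟩, Q.refl _⟩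
    | bwd z hz =>
      rw [map_zsmul]
      by_cases hzb : z = b
      · subst hzb
        rw [hfb, smul_smul]
        exact hwalk _ hd'
      · rw [hf hzb]
        exact ⟨_, _, Q.refl _, .bwd z ⟨hz, hzb⟩, Q.refl _⟩
  · induction x using Ext.induction with
    | hint n => simp
    | hgen z =>
      by_cases hzb : z = b
      · subst hzb
        obtain ⟨x, y, h1, h2, h3⟩ := hwalk S hd
        have hw : Walk r s t S Q (s z) (s z) [Ext.gen r z, (-csign r * k) • Ext.gen r d] :=
          .cons _ _ _ _ _ _ (Q.refl _) (.fwd z hb)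
            (((h2.walk Q).congr_left h1).congr_right h3)
        have := zsmul_mem hw.arnoldSum_mem (csign r)
        simp only [arnoldSum, List.prod_cons, List.prod_nil, mul_one, mul_zero, smul_zero,
          add_zero, smul_add, smul_smul, csign_mul_self, one_smul] at this
        rw [← mul_assoc, mul_neg, csign_mul_self, neg_one_mul, neg_smul, neg_add_eq_sub] at this
        rwa [hfb]
      · simp [hf hzb]
    | hadd x y hx hy =>
      rw [map_add, add_sub_add_comm]
      exact add_mem hx hy
    | hmul x y hx hy =>
      have : x * y - f (x * y) = (x - f x) * y + f x * (y - f y) := by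
        rw [map_mul]; noncomm_ring
      rw [this]
      exact add_mem (walkIdeal_mul_right hx _) (Ideal.mul_mem_left _ _ hy)
  · have : ((Ext.ret (S \ {b})).comp f).comp (Ext.ret S) = f.comp (Ext.ret S) := by
      refine Ext.hom_ext fun z => ?_
      by_cases hz : z ∈ S
      · simp only [RingHom.comp_apply, Ext.ret_gen_mem hz]
        by_cases hzb : z = b
        · subst hzb
          rw [hfb, map_zsmul, Ext.ret_gen_mem (show d ∈ S \ {z} from ⟨hd, hbd.symm⟩)]
        · rw [hf hzb, Ext.ret_gen_mem (show z ∈ S \ {b} from ⟨hz, hzb⟩)]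
      · simp [Ext.ret_gen_notMem hz]
    have := congr($this x)
    simpa [hx] using this
  · have : f.comp (Ext.ret {b}ᶜ) = Ext.ret {b}ᶜ := by
      refine Ext.hom_ext fun z => ?_
      by_cases hzb : z = b
      · subst hzb
        simp [Ext.ret_gen_notMem]
      · simp [Ext.ret_gen_mem (S := {b}ᶜ) (a := z) hzb, hf hzb]
    have := congr($this x)
    simpa [hx] using this

/-- Joint induction on the number of edges, over all `Q`. The first claim is injectivity, the second
detection by coefficients. In the absence of parallel edges, injectivity for `S` follows from
detection for `S \ {α}` and injectivity for the contractions; detection for `S` follows from the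
elimination of one generator and the same two claims for fewer edges. -/
theorem walkIdeal_finite_detection (r n : ℕ) : ∀ (S : Set X) (Q : Setoid V), S.Finite →
    S.ncard ≤ n → LooplessOn s t S Q →
    (∀ α ∈ S, ∀ x ∈ walkIdeal r s t S Q, Ext.ret (S \ {α}) x = x →
      x ∈ walkIdeal r s t (S \ {α}) Q) ∧
    ((∀ b ∈ S, ∀ d ∈ S, b ≠ d → ¬ Parallel s t Q b d) → ∀ x : Ext r X, Ext.ret S x = x →
      Ext.aug x = 0 →
      (∀ b ∈ S, Ext.coeff b x ∈ walkIdeal r s t (S \ {b}) (glue Q (s b) (t b))) →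
      x ∈ walkIdeal r s t S Q) := by
  induction n with
  | zero =>
    intro S Q hfin hcard _
    obtain rfl : S = ∅ := by
      rw [← Set.ncard_eq_zero hfin]; omega
    refine ⟨by simp, fun _ x hx h0 _ => ?_⟩
    rw [← hx, Ext.ret_empty, h0]
    simp
  | succ n ih =>
    intro S Q hfin hcard hl
    have hcard' {b} (hb : b ∈ S) : (S \ {b}).ncard ≤ n := by
      have := Set.ncard_sdiff_singleton_lt_of_mem hb hfin
      omega
    -- As `b` has no parallel edge, its contraction is loopless and the inductive injectivity
    -- applies there to the coefficient at `b`.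
    have hinj {b d : X} (hb : b ∈ S) (hd : d ∈ S) (hbd : b ≠ d)
        (hs : ∀ d ∈ S, b ≠ d → ¬ Parallel s t Q b d) {x : Ext r X}
        (hx : x ∈ walkIdeal r s t S Q) (hx' : Ext.ret (S \ {d}) x = x) :
        Ext.coeff b x ∈ walkIdeal r s t ((S \ {d}) \ {b}) (glue Q (s b) (t b)) := by
      have h1 := coeff_mem_walkIdeal (hl b hb) hx
      have h2 := (ih (S \ {b}) (glue Q (s b) (t b)) hfin.sdiff (hcard' hb)
        (hl.contract hs)).1 d ⟨hd, hbd.symm⟩ _ h1 (by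
          rw [Set.sdiff_sdiff_comm]
          exact Ext.ret_diff_coeff (show b ∈ S \ {d} from ⟨hb, hbd⟩) hx')
      rwa [Set.sdiff_sdiff_comm]
    constructor
    · intro α hα x hx hx'
      by_cases hs : ∀ b ∈ S, ∀ d ∈ S, b ≠ d → ¬ Parallel s t Q b d
      · refine (ih (S \ {α}) Q hfin.sdiff (hcard' hα) (hl.mono Set.sdiff_subset)).2
          (fun b hb d hd => hs b hb.1 d hd.1) x hx' (hl.aug_eq_zero hx) fun b hb => ?_
        exact hinj hb.1 hα hb.2 (hs b hb.1) hx hx'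
      · push Not at hs
        obtain ⟨b, hb, d, hd, hbd, hp⟩ := hs
        -- If `α` itself has a parallel edge, substituting for `e_α` fixes `x` and carries the ideal
        -- into that of `S \ {α}`.
        have hpar {d : X} (hd : d ∈ S) (hd' : α ≠ d) (hp : Parallel s t Q α d) :
            x ∈ walkIdeal r s t (S \ {α}) Q := by
          obtain ⟨f, h1, -, -, h4⟩ := hp.exists_subst r hd'
          rw [← h4 x (Ext.ret_eq_of_subset (fun _ h => h.2) hx')]
          exact h1 S hd x hx
        by_cases hbα : b = α
        · subst hbα
          exact hpar hd hbd hp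
        by_cases hdα : d = α
        · subst hdα
          exact hpar hb hbd.symm hp.symm
        -- The parallel pair now avoids `α`. Removing `b` by substitution changes `x` only by an
        -- element of the ideal of `S \ {α}`, so the claim reduces to `S \ {b}`.
        obtain ⟨f, h1, h2, h3, -⟩ := hp.exists_subst r hbd
        have h := (ih (S \ {b}) Q hfin.sdiff (hcard' hb) (hl.mono Set.sdiff_subset)).1 α
          ⟨hα, Ne.symm hbα⟩ (f x) (h1 S hd x hx) (by
            rw [Set.sdiff_sdiff_comm]
            exact h3 (S \ {α}) ⟨hd, hdα⟩ x hx')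
        rw [Set.sdiff_sdiff_comm] at h
        have h' := h2 (S \ {α}) ⟨hb, hbα⟩ ⟨hd, hdα⟩ x
        simpa using add_mem h' (walkIdeal_mono Set.sdiff_subset le_rfl h)
    · intro hs x hx h0 hc
      rcases S.eq_empty_or_nonempty with rfl | ⟨α, hα⟩
      · rw [← hx, Ext.ret_empty, h0]
        simp
      -- The coefficient at `α` allows `e_α` to be eliminated. The remaining hypotheses pass from
      -- `x` to `y`, since the augmentation kills the ideal and the coefficients map it into the
      -- contracted ideals.
      obtain ⟨y, hy, hxy⟩ := exists_sub_mem_walkIdeal hα hx (hc α hα)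
      have hyS : y ∈ walkIdeal r s t (S \ {α}) Q := by
        refine (ih (S \ {α}) Q hfin.sdiff (hcard' hα) (hl.mono Set.sdiff_subset)).2
          (fun b hb d hd => hs b hb.1 d hd.1) y hy ?_ fun b hb => ?_
        · have := hl.aug_eq_zero hxy
          rw [map_sub, h0] at this
          omega
        · have h1 : Ext.coeff b y ∈ walkIdeal r s t (S \ {b}) (glue Q (s b) (t b)) := by
            have := sub_mem (hc b hb.1) (coeff_mem_walkIdeal (hl b hb.1) hxy)
            simpa using this
          have h2 := (ih (S \ {b}) (glue Q (s b) (t b)) hfin.sdiff (hcard' hb.1)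
            (hl.contract (hs b hb.1))).1 α ⟨hα, Ne.symm hb.2⟩ _ h1 (by
              rw [Set.sdiff_sdiff_comm]
              exact Ext.ret_diff_coeff hb hy)
          rwa [Set.sdiff_sdiff_comm]
      simpa using add_mem hxy (walkIdeal_mono Set.sdiff_subset le_rfl hyS)

theorem Walk.exists_finite {a b : V} {L : List (Ext r X)} (h : Walk r s t S Q a b L) :
    ∃ F ⊆ S, F.Finite ∧ Walk r s t F Q a b L := by
  induction h with
  | nil a b h => exact ⟨∅, by simp, by simp, .nil _ _ h⟩
  | cons a x y b e L h he hL ih =>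
    obtain ⟨F, hF, hfin, hw⟩ := ih
    obtain ⟨d, hd, -, -, -, he'⟩ := he.exists_eq
    exact ⟨insert d F, Set.insert_subset hd hF, hfin.insert d, .cons _ _ _ _ _ _ h
      (he' _ (Set.mem_insert d F)) (hw.mono (Set.subset_insert d F) le_rfl)⟩

theorem exists_finite_mem_walkIdeal {x : Ext r X} (hx : x ∈ walkIdeal r s t S Q) :
    ∃ F ⊆ S, F.Finite ∧ x ∈ walkIdeal r s t F Q := by
  induction hx using walkIdeal_induction with
  | harn a L h =>
    obtain ⟨F, hF, hfin, hw⟩ := h.exists_finite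
    exact ⟨F, hF, hfin, hw.arnoldSum_mem⟩
  | hzero => exact ⟨∅, by simp, by simp, zero_mem _⟩
  | hadd x y _ _ hx hy =>
    obtain ⟨F, hF, hfin, hx⟩ := hx
    obtain ⟨G, hG, hfin', hy⟩ := hy
    exact ⟨F ∪ G, Set.union_subset hF hG, hfin.union hfin',
      add_mem (walkIdeal_mono Set.subset_union_left le_rfl hx)
        (walkIdeal_mono Set.subset_union_right le_rfl hy)⟩
  | hmul x y _ hy =>
    obtain ⟨F, hF, hfin, hy⟩ := hy
    exact ⟨F, hF, hfin, Ideal.mul_mem_left _ _ hy⟩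

/-- Only finitely many edges matter: those of finitely many walks witnessing membership, those
occurring in `x`, and `α`. -/
theorem mem_walkIdeal_of_ret (hl : LooplessOn s t S Q) (hα : α ∈ S) {x : Ext r X}
    (hx : x ∈ walkIdeal r s t S Q) (hx' : Ext.ret (S \ {α}) x = x) :
    x ∈ walkIdeal r s t (S \ {α}) Q := by
  obtain ⟨F, hF, hfin, hxF⟩ := exists_finite_mem_walkIdeal hx
  obtain ⟨G, hG⟩ := Ext.exists_finset_ret x
  have hsub : insert α (F ∪ (S ∩ G)) ⊆ S :=
    Set.insert_subset hα (Set.union_subset hF Set.inter_subset_left)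
  have hfin' : (insert α (F ∪ (S ∩ G))).Finite :=
    (hfin.union (G.finite_toSet.subset Set.inter_subset_right)).insert α
  refine walkIdeal_mono (Set.sdiff_subset_sdiff_left hsub) le_rfl
    ((walkIdeal_finite_detection r _ _ Q hfin' le_rfl (hl.mono hsub)).1 α (Set.mem_insert ..) x
      (walkIdeal_mono (fun z hz => .inr (.inl hz)) le_rfl hxF) ?_)
  have h1 : Ext.ret ((S \ {α}) ∩ G) x = x := by rw [← Ext.ret_ret, hG, hx']
  have h2 : (S \ {α}) ∩ G ⊆ insert α (F ∪ (S ∩ G)) \ {α} :=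
    fun z hz => ⟨.inr (.inr ⟨hz.1.1, hz.2⟩), hz.1.2⟩
  exact Ext.ret_eq_of_subset h2 h1

end Injectivity

/-! ### Homogeneous components and homogeneity of the ideals -/

section Grading

variable {r : ℕ} {X Y : Type*}

/-- The part of degree `k`. -/
def Ext.deg (r : ℕ) (X : Type*) (k : ℤ) : AddSubgroup (Ext r X) :=
  (Lam.deg r X k).map (Ext.equiv r X : Lam r X →+* Ext r X).toAddMonoidHom

theorem Ext.prod_mem_deg {l : List X} {k : ℤ} (h : (l.length : ℤ) * ((r : ℤ) - 1) = k) :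
    (l.map (Ext.gen r)).prod ∈ Ext.deg r X k := by
  refine ⟨_, AddSubgroup.subset_closure ⟨l, h, rfl⟩, ?_⟩
  change Ext.equiv r X _ = _
  rw [Lam.mon, map_list_prod, List.map_map]
  rfl

@[elab_as_elim]
theorem Ext.deg_induction {k : ℤ} {P : (x : Ext r X) → x ∈ Ext.deg r X k → Prop}
    (hprod : ∀ (l : List X) (hl : (l.length : ℤ) * ((r : ℤ) - 1) = k),
      P (l.map (Ext.gen r)).prod (Ext.prod_mem_deg hl))
    (hzero : P 0 (zero_mem _))
    (hadd : ∀ x y hx hy, P x hx → P y hy → P (x + y) (add_mem hx hy))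
    (hneg : ∀ x hx, P x hx → P (-x) (neg_mem hx)) {x : Ext r X} (hx : x ∈ Ext.deg r X k) :
    P x hx := by
  suffices ∃ h, P x h from this.2
  obtain ⟨z, hz, rfl⟩ := hx
  change ∃ h, P (Ext.equiv r X z) h
  induction hz using AddSubgroup.closure_induction with
  | mem x hx =>
    obtain ⟨l, hl, rfl⟩ := hx
    rw [Lam.mon, map_list_prod, List.map_map]
    exact ⟨_, hprod l hl⟩
  | zero => rw [map_zero]; exact ⟨_, hzero⟩
  | add x y _ _ hx hy => rw [map_add]; exact ⟨_, hadd _ _ _ _ hx.2 hy.2⟩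
  | neg x _ hx => rw [map_neg]; exact ⟨_, hneg _ _ hx.2⟩

theorem Ext.gen_mem_deg (a : X) : Ext.gen r a ∈ Ext.deg r X ((r : ℤ) - 1) := by
  simpa using Ext.prod_mem_deg (r := r) (l := [a]) rfl

theorem Ext.one_mem_deg : (1 : Ext r X) ∈ Ext.deg r X 0 := by
  simpa using Ext.prod_mem_deg (r := r) (X := X) (l := []) rfl

theorem Ext.mul_mem_deg {k l : ℤ} {x y : Ext r X} (hx : x ∈ Ext.deg r X k)
    (hy : y ∈ Ext.deg r X l) : x * y ∈ Ext.deg r X (k + l) := by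
  induction hx using Ext.deg_induction with
  | hprod u hu =>
    induction hy using Ext.deg_induction with
    | hprod w hw =>
      rw [← List.prod_append, ← List.map_append]
      apply Ext.prod_mem_deg
      rw [List.length_append, ← hu, ← hw]
      push_cast
      ring
    | hzero => simp
    | hadd x y _ _ hx hy => rw [mul_add]; exact add_mem hx hy
    | hneg x _ hx => rw [mul_neg]; exact neg_mem hx
  | hzero => simp
  | hadd x y _ _ hx hy => rw [add_mul]; exact add_mem hx hy
  | hneg x _ hx => rw [neg_mul]; exact neg_mem hx

theorem Ext.map_mem_deg (f : Ext r X →+* Ext r Y)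
    (hf : ∀ a, f (Ext.gen r a) ∈ Ext.deg r Y ((r : ℤ) - 1)) {k : ℤ} {x : Ext r X}
    (hx : x ∈ Ext.deg r X k) : f x ∈ Ext.deg r Y k := by
  induction hx using Ext.deg_induction with
  | hprod l hl =>
    induction l generalizing k with
    | nil =>
      obtain rfl : 0 = k := by simpa using hl
      simpa using Ext.one_mem_deg
    | cons a l ih =>
      rw [List.map_cons, List.prod_cons, map_mul]
      convert Ext.mul_mem_deg (hf a) (ih rfl) using 2
      rw [← hl, List.length_cons]
      push_cast
      ring
  | hzero => simp
  | hadd x y _ _ hx hy => rw [map_add]; exact add_mem hx hy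
  | hneg x _ hx => rw [map_neg]; exact neg_mem hx

theorem Ext.ret_mem_deg (S : Set X) {k : ℤ} {x : Ext r X} (hx : x ∈ Ext.deg r X k) :
    Ext.ret S x ∈ Ext.deg r X k := by
  refine Ext.map_mem_deg _ (fun a => ?_) hx
  by_cases h : a ∈ S
  · rw [Ext.ret_gen_mem h]; exact Ext.gen_mem_deg a
  · rw [Ext.ret_gen_notMem h]; exact zero_mem _

theorem Ext.twist_mem_deg {k : ℤ} {x : Ext r X} (hx : x ∈ Ext.deg r X k) :
    Ext.twist x ∈ Ext.deg r X k := by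
  refine Ext.map_mem_deg _ (fun a => ?_) hx
  rw [Ext.twist_gen]
  exact zsmul_mem (Ext.gen_mem_deg a) _

theorem Ext.coeff_mem_deg (α : X) {k : ℤ} {x : Ext r X} (hx : x ∈ Ext.deg r X k) :
    Ext.coeff α x ∈ Ext.deg r X (k - r + 1) := by
  induction hx using Ext.deg_induction with
  | hprod l hl =>
    induction l generalizing k with
    | nil => simp
    | cons a l ih =>
      rw [List.map_cons, List.prod_cons, Ext.coeff_mul]
      have hk : ((l.length : ℤ) * ((r : ℤ) - 1)) = k - r + 1 := by
        rw [← hl, List.length_cons]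
        push_cast
        ring
      refine add_mem ?_ ?_
      · convert Ext.mul_mem_deg (Ext.ret_mem_deg _ (Ext.gen_mem_deg a)) (ih rfl) using 2
        rw [hk]
        ring
      · by_cases h : a = α
        · subst h
          rw [Ext.coeff_gen_self, one_mul]
          exact Ext.twist_mem_deg (Ext.ret_mem_deg _ (Ext.prod_mem_deg hk))
        · simp [Ext.coeff_gen_ne h]
  | hzero => simp
  | hadd x y _ _ hx hy => rw [map_add]; exact add_mem hx hy
  | hneg x _ hx => rw [map_neg]; exact neg_mem hx

/-- The coaction of the grading. -/
def Ext.grading : Ext r X →+* AddMonoidAlgebra (Ext r X) ℤ :=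
  Ext.lift (fun a => AddMonoidAlgebra.single ((r : ℤ) - 1) (Ext.gen r a))
    (fun a => by rw [AddMonoidAlgebra.single_mul_single, Ext.gen_sq, AddMonoidAlgebra.single_zero])
    (fun a b => by
      rw [AddMonoidAlgebra.single_mul_single, AddMonoidAlgebra.single_mul_single,
        AddMonoidAlgebra.smul_single, Ext.gen_comm])

/-- The homogeneous component of degree `k`. -/
def Ext.proj (k : ℤ) : Ext r X →+ Ext r X where
  toFun x := (Ext.grading x).coeff k
  map_zero' := by simp
  map_add' := by simp

theorem Ext.proj_intCast (n k : ℤ) :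
    Ext.proj k (n : Ext r X) = if k = 0 then (n : Ext r X) else 0 := by
  simp only [Ext.proj, AddMonoidHom.coe_mk, ZeroHom.coe_mk, map_intCast,
    AddMonoidAlgebra.intCast_def, AddMonoidAlgebra.coeff_single, Finsupp.single_apply, eq_comm]

theorem Ext.proj_gen_mul (a : X) (x : Ext r X) (k : ℤ) :
    Ext.proj k (Ext.gen r a * x) = Ext.gen r a * Ext.proj (-((r : ℤ) - 1) + k) x := by
  simp only [Ext.proj, AddMonoidHom.coe_mk, ZeroHom.coe_mk, map_mul, Ext.grading, Ext.lift_gen]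
  rw [AddMonoidAlgebra.coeff_single_mul_apply]

theorem Ext.grading_prod (L : List (Ext r X))
    (h : ∀ e ∈ L, Ext.grading e = AddMonoidAlgebra.single ((r : ℤ) - 1) e) :
    Ext.grading L.prod = AddMonoidAlgebra.single ((L.length : ℤ) * ((r : ℤ) - 1)) L.prod := by
  induction L with
  | nil =>
    rw [List.prod_nil, map_one, AddMonoidAlgebra.one_def, List.length_nil, Nat.cast_zero, zero_mul]
  | cons a L ih =>
    rw [List.prod_cons, map_mul, h a (by simp), ih fun e he => h e (by simp [he]),
      AddMonoidAlgebra.single_mul_single, List.length_cons]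
    congr 1
    push_cast
    ring

theorem Ext.grading_arnoldSum (L : List (Ext r X))
    (h : ∀ e ∈ L, Ext.grading e = AddMonoidAlgebra.single ((r : ℤ) - 1) e) :
    Ext.grading (arnoldSum r L) =
      AddMonoidAlgebra.single (((L.length : ℤ) - 1) * ((r : ℤ) - 1)) (arnoldSum r L) := by
  induction L with
  | nil => rw [arnoldSum, map_zero, AddMonoidAlgebra.single_zero]
  | cons a L ih =>
    have hL : ∀ e ∈ L, Ext.grading e = AddMonoidAlgebra.single ((r : ℤ) - 1) e :=
      fun e he => h e (by simp [he])
    rw [arnoldSum, map_add, map_zsmul, map_mul, h a (by simp), ih hL, Ext.grading_prod L hL,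
      AddMonoidAlgebra.single_mul_single, AddMonoidAlgebra.smul_single, List.length_cons,
      AddMonoidAlgebra.single_add]
    have h1 : ((L.length + 1 : ℕ) : ℤ) - 1 = L.length := by push_cast; ring
    have h2 : (r : ℤ) - 1 + ((L.length : ℤ) - 1) * ((r : ℤ) - 1) = L.length * ((r : ℤ) - 1) := by
      ring
    rw [h1, h2]

/-- The family `D` is arbitrary so that one induction covers both the graded pieces of `Λ` and a
constant family given by an ideal. -/
theorem Ext.proj_mul_mem {D : ℤ → AddSubgroup (Ext r X)}
    (hD : ∀ k a x, x ∈ D (-((r : ℤ) - 1) + k) → Ext.gen r a * x ∈ D k) (x : Ext r X)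
    {y : Ext r X} (hy : ∀ k, Ext.proj k y ∈ D k) (k : ℤ) : Ext.proj k (x * y) ∈ D k := by
  induction x using Ext.induction generalizing y k with
  | hint n =>
    rw [← zsmul_eq_mul, map_zsmul]
    exact zsmul_mem (hy k) n
  | hgen a =>
    rw [Ext.proj_gen_mul]
    exact hD _ _ _ (hy _)
  | hadd x x' hx hx' =>
    rw [add_mul, map_add]
    exact add_mem (hx hy k) (hx' hy k)
  | hmul x x' hx hx' =>
    rw [mul_assoc]
    exact hx (fun k => hx' hy k) k

theorem Ext.proj_mem_deg (x : Ext r X) (k : ℤ) : Ext.proj k x ∈ Ext.deg r X k := by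
  have := Ext.proj_mul_mem (D := Ext.deg r X) (fun k a x hx => by
    convert Ext.mul_mem_deg (Ext.gen_mem_deg a) hx using 2
    ring) x (y := 1) (fun k => by
      have := Ext.proj_intCast (r := r) (X := X) 1 k
      rw [Int.cast_one] at this
      rw [this]
      split_ifs with h
      · rw [h]; exact Ext.one_mem_deg
      · exact zero_mem _) k
  rwa [mul_one] at this

theorem Ext.proj_eq_self {k : ℤ} {x : Ext r X} (hx : x ∈ Ext.deg r X k) : Ext.proj k x = x := by
  induction hx using Ext.deg_induction with
  | hprod l hl =>
    have h := Ext.grading_prod (l.map (Ext.gen r)) (fun e he => by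
      obtain ⟨a, -, rfl⟩ := List.mem_map.1 he
      exact Ext.lift_gen ..)
    simp only [Ext.proj, AddMonoidHom.coe_mk, ZeroHom.coe_mk, h, List.length_map, hl,
      AddMonoidAlgebra.coeff_single, Finsupp.single_eq_same]
  | hzero => simp
  | hadd x y _ _ hx hy => rw [map_add, hx, hy]
  | hneg x _ hx => rw [map_neg, hx]

theorem Ext.proj_ret (S : Set X) (k : ℤ) (x : Ext r X) :
    Ext.proj k (Ext.ret S x) = Ext.ret S (Ext.proj k x) := by
  have : Ext.grading.comp (Ext.ret S) =
      (AddMonoidAlgebra.mapRingHom ℤ (Ext.ret (r := r) S)).comp Ext.grading := by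
    refine Ext.hom_ext fun a => ?_
    by_cases h : a ∈ S
    · rw [RingHom.comp_apply, RingHom.comp_apply, Ext.ret_gen_mem h, Ext.grading, Ext.lift_gen,
        AddMonoidAlgebra.mapRingHom_single, Ext.ret_gen_mem h]
    · rw [RingHom.comp_apply, RingHom.comp_apply, Ext.ret_gen_notMem h, Ext.grading, Ext.lift_gen,
        AddMonoidAlgebra.mapRingHom_single, Ext.ret_gen_notMem h, map_zero,
        AddMonoidAlgebra.single_zero]
  have h := congr(AddMonoidAlgebra.coeff ($this x) k)
  simpa [Ext.proj] using h

/-- The Arnold sum of a walk of length `l` is homogeneous of degree `(l - 1)(r - 1)`. -/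
theorem proj_mem_walkIdeal {V : Type*} {s t : X → V} {S : Set X} {Q : Setoid V} {x : Ext r X}
    (hx : x ∈ walkIdeal r s t S Q) (k : ℤ) : Ext.proj k x ∈ walkIdeal r s t S Q := by
  induction hx using walkIdeal_induction generalizing k with
  | harn a L h =>
    have h' := Ext.grading_arnoldSum L (fun e he => by
      obtain ⟨b, -, j, -, rfl⟩ := h.exists_eq he
      rw [map_zsmul, ← AddMonoidAlgebra.smul_single]
      congr 1
      exact Ext.lift_gen ..)
    simp only [Ext.proj, AddMonoidHom.coe_mk, ZeroHom.coe_mk, h', AddMonoidAlgebra.coeff_single,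
      Finsupp.single_apply]
    split_ifs
    · exact h.arnoldSum_mem
    · exact zero_mem _
  | hzero => simp
  | hadd x y _ _ hx hy => rw [map_add]; exact add_mem (hx k) (hy k)
  | hmul x y _ hy =>
    exact Ext.proj_mul_mem (D := fun _ => (walkIdeal r s t S Q).toAddSubgroup)
      (fun k a x hx => Ideal.mul_mem_left _ _ hx) x hy k

end Grading

/-! ### Passing between an edge set of its own and a subset of a larger one -/

section Transport

variable {r : ℕ} {X Y : Type*}

open Classical in
/-- The retraction of `Ext.map j` for an injection `j`. -/
def Ext.pull (j : Y → X) : Ext r X →+* Ext r Y :=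
  Ext.lift (fun a => if h : ∃ b, j b = a then Ext.gen r h.choose else 0)
    (fun a => by split_ifs <;> simp [Ext.gen_sq])
    (fun a b => by
      split_ifs with h h'
      · exact Ext.gen_comm _ _
      all_goals simp)

theorem Ext.pull_gen {j : Y → X} (hj : j.Injective) (b : Y) :
    Ext.pull j (Ext.gen r (j b)) = Ext.gen r b := by
  have h : ∃ b', j b' = j b := ⟨b, rfl⟩
  rw [Ext.pull, Ext.lift_gen, dif_pos h, hj h.choose_spec]

theorem Ext.pull_gen_notMem {j : Y → X} {a : X} (ha : a ∉ Set.range j) :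
    Ext.pull j (Ext.gen r a) = 0 := by
  have h : ¬ ∃ b, j b = a := ha
  rw [Ext.pull, Ext.lift_gen, dif_neg h]

theorem Ext.pull_map {j : Y → X} (hj : j.Injective) (x : Ext r Y) :
    Ext.pull j (Ext.map j x) = x := by
  have : (Ext.pull j).comp (Ext.map (r := r) j) = RingHom.id _ :=
    Ext.hom_ext fun b => by
      rw [RingHom.comp_apply, Ext.map_gen, Ext.pull_gen hj, RingHom.id_apply]
  exact congr($this x)

theorem Ext.map_pull {j : Y → X} (hj : j.Injective) (x : Ext r X) :
    Ext.map j (Ext.pull j x) = Ext.ret (Set.range j) x := by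
  have : (Ext.map (r := r) j).comp (Ext.pull j) = Ext.ret (Set.range j) := by
    refine Ext.hom_ext fun a => ?_
    by_cases ha : a ∈ Set.range j
    · rw [Ext.ret_gen_mem ha]
      obtain ⟨b, rfl⟩ := ha
      rw [RingHom.comp_apply, Ext.pull_gen hj, Ext.map_gen]
    · rw [Ext.ret_gen_notMem ha, RingHom.comp_apply, Ext.pull_gen_notMem ha, map_zero]
  exact congr($this x)

theorem Ext.map_edge_mem_deg (j : Y → X) {k : ℤ} {x : Ext r Y} (hx : x ∈ Ext.deg r Y k) :
    Ext.map j x ∈ Ext.deg r X k :=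
  Ext.map_mem_deg _ (fun a => by rw [Ext.map_gen]; exact Ext.gen_mem_deg _) hx

theorem Ext.pull_mem_deg {j : Y → X} (hj : j.Injective) {k : ℤ} {x : Ext r X}
    (hx : x ∈ Ext.deg r X k) : Ext.pull j x ∈ Ext.deg r Y k := by
  refine Ext.map_mem_deg _ (fun a => ?_) hx
  by_cases ha : a ∈ Set.range j
  · obtain ⟨b, rfl⟩ := ha
    rw [Ext.pull_gen hj]
    exact Ext.gen_mem_deg b
  · rw [Ext.pull_gen_notMem ha]
    exact zero_mem _

/-- Walks are carried forward along `p` and back along a section of `p`, which is compatible with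
steps because walks are only taken up to `Q`. -/
theorem map_mem_walkIdeal_iff {V W : Type*} {s t : X → V} {s' t' : Y → W} {j : Y → X}
    (hj : j.Injective) {p : V → W} (hp : p.Surjective) {Q : Setoid V}
    (hQ : ∀ x y, Q x y ↔ p x = p y) (hs : ∀ b, s' b = p (s (j b))) (ht : ∀ b, t' b = p (t (j b)))
    {S : Set X} (hS : Set.range j = S) (x : Ext r Y) :
    Ext.map j x ∈ walkIdeal r s t S Q ↔ x ∈ walkIdeal r s' t' Set.univ ⊥ := by
  subst hS
  constructor
  · intro h
    rw [← Ext.pull_map hj x]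
    refine walkIdeal_map (Ext.pull j) p (fun x y h => (hQ x y).1 h) (fun x y e he => ?_) h
    rcases he with ⟨_, b, rfl⟩ | ⟨_, b, rfl⟩
    · rw [Ext.pull_gen hj]
      exact ⟨_, _, (hs b).symm, .fwd b trivial, ht b⟩
    · rw [map_zsmul, Ext.pull_gen hj]
      exact ⟨_, _, (ht b).symm, .bwd b trivial, hs b⟩
  · intro h
    have hinv (v : V) : Q (Function.surjInv hp (p v)) v := (hQ _ _).2 (Function.surjInv_eq hp _)
    refine walkIdeal_map (Ext.map j) (Function.surjInv hp) (fun x y h => ?_)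
      (fun x y e he => ?_) h
    · obtain rfl : x = y := h
      exact Q.refl _
    · rcases he with ⟨b, -⟩ | ⟨b, -⟩
      · rw [Ext.map_gen, hs, ht]
        exact ⟨_, _, hinv _, .fwd _ ⟨b, rfl⟩, Q.symm (hinv _)⟩
      · rw [map_zsmul, Ext.map_gen, hs, ht]
        exact ⟨_, _, hinv _, .bwd _ ⟨b, rfl⟩, Q.symm (hinv _)⟩

end Transport

/-! ### Circuits versus walks: the Arnold ideal is a walk ideal -/

section Comparison

variable {r : ℕ} {X V E : Type*}

/-- The algebra elements of the edges in a list with the signs `κ`. -/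
def signedList (r : ℕ) (w : List X) (κ : ℕ → ℤ) : List (Ext r X) :=
  List.ofFn fun i : Fin w.length => κ i • Ext.gen r w[i]

theorem signedList_cons (b : X) (w : List X) (κ : ℕ → ℤ) :
    signedList r (b :: w) κ = κ 0 • Ext.gen r b :: signedList r w (fun n => κ (n + 1)) := by
  simp [signedList, List.ofFn_succ, -zsmul_eq_mul]

/-- `k` is the product of all signs. Omitting the `i`-th factor drops the sign `κ i`, which amounts
to multiplying `k` by `κ i`. -/
theorem arnoldSum_signedList (w : List X) (κ : ℕ → ℤ) (hκ : ∀ i, κ i * κ i = 1) :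
    ∃ k : ℤ, k * k = 1 ∧ (signedList r w κ).prod = k • (w.map (Ext.gen r)).prod ∧
      arnoldSum r (signedList r w κ) = k • ∑ i : Fin w.length,
        (csign r ^ (i : ℕ) * κ i) • ((w.eraseIdx i).map (Ext.gen r)).prod := by
  induction w generalizing κ with
  | nil => exact ⟨1, by simp, by simp [signedList], by simp [signedList, arnoldSum]⟩
  | cons b w ih =>
    obtain ⟨k, hk, h1, h2⟩ := ih (fun n => κ (n + 1)) (fun i => hκ _)
    refine ⟨κ 0 * k, by rw [mul_mul_mul_comm, hκ, hk, one_mul], ?_, ?_⟩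
    · rw [signedList_cons, List.prod_cons, h1, List.map_cons, List.prod_cons,
        smul_mul_smul_comm]
    · rw [signedList_cons, arnoldSum, h1, h2]
      change _ = _ • ∑ i : Fin (w.length + 1), _
      rw [Fin.sum_univ_succ]
      simp only [Fin.val_zero, Fin.val_succ, List.eraseIdx_zero, List.tail_cons,
        List.eraseIdx_cons_succ, List.map_cons, List.prod_cons, smul_add, Finset.smul_sum,
        Finset.mul_sum, smul_mul_assoc, mul_smul_comm, smul_smul, pow_zero, one_mul]
      congr 1
      · rw [mul_comm (κ 0) k, mul_assoc, hκ, mul_one]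
      · refine Finset.sum_congr rfl fun i _ => ?_
        congr 1
        ring

variable {G : Graph V E} {o : E → V} {s t : E(G) → V}

theorem equiv_arnold (w : List E(G)) (v : ℕ → V) (κ : ℕ → ℤ)
    (heven : Even r → ∀ i : Fin w.length, κ i = 1)
    (hodd : Odd r → ∀ i : Fin w.length, (o (w[i] : E) = v i → κ i = 1) ∧
      (o (w[i] : E) ≠ v i → κ i = -1)) :
    Ext.equiv r E(G) (arnold r o w v) = ∑ i : Fin w.length,
        (csign r ^ (i : ℕ) * κ i) • ((w.eraseIdx i).map (Ext.gen r)).prod := by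
  rw [arnold, map_sum]
  refine Finset.sum_congr rfl fun i _ => ?_
  have hmon : Ext.equiv r E(G) (Lam.mon r (w.eraseIdx i)) =
      ((w.eraseIdx i).map (Ext.gen r)).prod := by
    rw [Lam.mon, map_list_prod, List.map_map]
    rfl
  rw [map_mul, hmon, zsmul_eq_mul]
  congr 1
  rw [arnoldSign]
  rcases Nat.even_or_odd r with hr | hr
  · have hc : csign r = -1 := Odd.neg_one_pow hr.add_one
    rw [if_pos hr, heven hr i, hc]
    simp
  · have hc : csign r = 1 := Even.neg_one_pow hr.add_one
    rw [if_neg (Nat.not_even_iff_odd.2 hr), hc]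
    by_cases h : o (w[i] : E) = v i
    · rw [if_pos h, (hodd hr i).1 h]
      simp
    · rw [if_neg h, (hodd hr i).2 h]
      simp

theorem Walk.of_isLink (hlink : ∀ b : E(G), G.IsLink b (s b) (t b)) (w : List E(G)) (v : ℕ → V)
    (hw : ∀ (i : ℕ) (h : i < w.length), G.IsLink (w[i] : E) (v i) (v (i + 1))) (κ : ℕ → ℤ)
    (hκ : ∀ (i : ℕ) (h : i < w.length), (s w[i] = v i → κ i = 1) ∧
      (s w[i] ≠ v i → κ i = -csign r)) :
    Walk r s t Set.univ ⊥ (v 0) (v w.length) (signedList r w κ) := by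
  induction w generalizing v κ with
  | nil => exact .nil _ _ rfl
  | cons b w ih =>
    rw [signedList_cons]
    have h0 : G.IsLink b (v 0) (v 1) := hw 0 (by simp)
    have hκ0 : (s b = v 0 → κ 0 = 1) ∧ (s b ≠ v 0 → κ 0 = -csign r) := hκ 0 (by simp)
    have hstep : Step r s t Set.univ (v 0) (v 1) (κ 0 • Ext.gen r b) := by
      rcases (hlink b).eq_and_eq_or_eq_and_eq h0 with ⟨h1, h2⟩ | ⟨h1, h2⟩
      · rw [hκ0.1 h1, ← h1, ← h2, one_smul]
        exact .fwd b trivial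
      -- The ends match crosswise. If `s b = v 0` as well, then `b` is a loop, and the sign
      -- convention counts it as run through forwards.
      · by_cases h : s b = v 0
        · rw [hκ0.1 h, one_smul]
          convert Step.fwd (r := r) (s := s) (t := t) b (Set.mem_univ b) using 1
          · exact h.symm
          · rw [h2, ← h, h1]
        · rw [hκ0.2 h, ← h1, ← h2]
          exact .bwd b trivial
    exact .cons _ _ _ _ _ _ rfl hstep (ih (fun n => v (n + 1)) (fun i h => hw (i + 1) (by simpa))
      (fun n => κ (n + 1)) (fun i h => hκ (i + 1) (by simpa)))

theorem Walk.exists_list (hlink : ∀ b : E(G), G.IsLink b (s b) (t b)) {a b : V}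
    {L : List (Ext r E(G))} (h : Walk r s t Set.univ ⊥ a b L) :
    ∃ (w : List E(G)) (v : ℕ → V) (κ : ℕ → ℤ), L = signedList r w κ ∧ v 0 = a ∧
      v w.length = b ∧ (∀ i, κ i * κ i = 1) ∧
      ∀ (i : ℕ) (h : i < w.length), G.IsLink (w[i] : E) (v i) (v (i + 1)) ∧
        ((v i = s w[i] ∧ κ i = 1) ∨ (v i = t w[i] ∧ κ i = -csign r)) := by
  induction h with
  | nil a b h => exact ⟨[], fun _ => a, fun _ => 1, by simp [signedList], rfl, h, by simp, by simp⟩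
  | cons a x y b e L h he hL ih =>
    obtain rfl : a = x := h
    obtain ⟨w, v, κ, rfl, rfl, rfl, hκ, hw⟩ := ih
    obtain ⟨d, k, hk, rfl, hd⟩ : ∃ (d : E(G)) (k : ℤ), k * k = 1 ∧ e = k • Ext.gen r d ∧
        G.IsLink d a (v 0) ∧ ((a = s d ∧ k = 1) ∨ (a = t d ∧ k = -csign r)) := by
      generalize v 0 = y at he
      rcases he with ⟨d, -⟩ | ⟨d, -⟩
      · exact ⟨d, 1, by simp, by simp, hlink d, .inl ⟨rfl, rfl⟩⟩
      · exact ⟨d, -csign r, by simp [csign_mul_self], rfl, (hlink d).symm, .inr ⟨rfl, rfl⟩⟩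
    refine ⟨d :: w, fun n => Nat.casesOn n a v, fun n => Nat.casesOn n k κ,
      (signedList_cons d w fun n => Nat.casesOn n k κ).symm, rfl, rfl, ?_, ?_⟩
    · rintro (_ | i)
      · exact hk
      · exact hκ i
    · rintro (_ | i) hi
      · exact hd
      · exact hw i (by simpa using hi)

/-- For `r` even a step has the same sign in both directions; for `r` odd the sign is that of the
orientation. The Arnold class and the Arnold sum then differ by a global sign. -/
theorem mem_arnoldIdeal_iff (hlink : ∀ b : E(G), G.IsLink b (s b) (t b))
    (hs : Odd r → ∀ b, s b = o b) (x : Lam r E(G)) :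
    x ∈ arnoldIdeal r G o ↔ Ext.equiv r E(G) x ∈ walkIdeal r s t Set.univ ⊥ := by
  constructor
  · intro hx
    induction hx using TwoSidedIdeal.span_induction with
    | mem x hx =>
      classical
      obtain ⟨w, v, hw, rfl⟩ := hx
      let κ : ℕ → ℤ := fun i =>
        if h : i < w.length then (if s w[i] = v i then 1 else -csign r) else 1
      have hκ' (i : ℕ) : κ i * κ i = 1 := by
        simp only [κ]
        split_ifs <;> simp [csign_mul_self]
      have hκ (i : ℕ) (h : i < w.length) : (s w[i] = v i → κ i = 1) ∧
          (s w[i] ≠ v i → κ i = -csign r) := by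
        simp only [κ, dif_pos h]
        exact ⟨fun h => if_pos h, fun h => if_neg h⟩
      have hwalk := Walk.of_isLink (r := r) hlink w v hw.link κ hκ
      rw [hw.closed] at hwalk
      obtain ⟨k, hk, -, hsum⟩ := arnoldSum_signedList (r := r) w κ hκ'
      rw [equiv_arnold w v κ]
      · have := zsmul_mem hwalk.arnoldSum_mem k
        rwa [hsum, smul_smul, hk, one_smul] at this
      · intro hr i
        have hc : csign r = -1 := Odd.neg_one_pow hr.add_one
        by_cases h : s w[i] = v i
        · exact (hκ i i.2).1 h
        · rw [(hκ i i.2).2 h, hc, neg_neg]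
      · intro hr i
        have hc : csign r = 1 := Even.neg_one_pow hr.add_one
        rw [← hs hr]
        refine ⟨(hκ i i.2).1, fun h => ?_⟩
        rw [(hκ i i.2).2 h, hc]
    | zero => rw [map_zero]; exact zero_mem _
    | add x y _ _ hx hy => rw [map_add]; exact add_mem hx hy
    | neg x _ hx => rw [map_neg]; exact neg_mem hx
    | left_absorb a x _ hx => rw [map_mul]; exact Ideal.mul_mem_left _ _ hx
    | right_absorb a x _ hx => rw [map_mul]; exact walkIdeal_mul_right hx _
  · suffices ∀ z ∈ walkIdeal r s t Set.univ ⊥, (Ext.equiv r E(G)).symm z ∈ arnoldIdeal r G o by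
      intro h
      simpa using this _ h
    intro z hz
    -- For `r` odd a backward step along a loop has sign `-1`, against the convention for circuits.
    -- This is harmless, as a loop puts `1` into the Arnold ideal.
    by_cases hloop : Odd r ∧ ∃ b, s b = t b
    · obtain ⟨hr, b, hb⟩ := hloop
      have h1 : (1 : Lam r E(G)) ∈ arnoldIdeal r G o := by
        refine TwoSidedIdeal.subset_span ⟨[b], fun _ => s b, ⟨by simp, ?_, rfl⟩, ?_⟩
        · intro i hi
          obtain rfl : i = 0 := by simpa using hi
          have := hlink b
          rwa [← hb] at this
        · have : o b = s b := (hs hr b).symm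
          change 1 = ∑ i : Fin 1, _
          rw [Fin.sum_univ_one]
          have hr' := Nat.not_even_iff_odd.2 hr
          simp [arnoldSign, Lam.mon, this, hr']
      simpa using TwoSidedIdeal.mul_mem_left _ ((Ext.equiv r E(G)).symm z) _ h1
    induction hz using walkIdeal_induction with
    | harn a L h =>
      obtain ⟨w, v, κ, rfl, h0, h1, hκ, hw⟩ := h.exists_list hlink
      obtain ⟨k, hk, -, hsum⟩ := arnoldSum_signedList (r := r) w κ hκ
      rcases eq_or_ne w [] with rfl | hne
      · simp only [signedList, List.ofFn_zero, List.length_nil, arnoldSum, map_zero]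
        exact zero_mem _
      have hmem : arnold r o w v ∈ arnoldIdeal r G o :=
        TwoSidedIdeal.subset_span ⟨w, v, ⟨hne, fun i hi => (hw i hi).1, h1.trans h0.symm⟩, rfl⟩
      rw [hsum, ← equiv_arnold (o := o) w v κ, map_zsmul, RingEquiv.symm_apply_apply]
      · exact zsmul_mem hmem k
      · intro hr i
        have hc : csign r = -1 := Odd.neg_one_pow hr.add_one
        rcases (hw i i.2).2 with ⟨-, h⟩ | ⟨-, h⟩
        · exact h
        · rw [h, hc, neg_neg]
      · intro hr i
        have hc : csign r = 1 := Even.neg_one_pow hr.add_one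
        rw [← hs hr]
        rcases (hw i i.2).2 with ⟨h, h'⟩ | ⟨h, h'⟩
        · exact ⟨fun _ => h', fun h'' => absurd h.symm h''⟩
        · refine ⟨fun h'' => absurd ⟨hr, _, h''.trans h⟩ hloop, fun _ => ?_⟩
          rw [h', hc]
    | hzero => rw [map_zero]; exact zero_mem _
    | hadd x y _ _ hx hy => rw [map_add]; exact add_mem hx hy
    | hmul x y _ hy => rw [map_mul]; exact TwoSidedIdeal.mul_mem_left _ _ _ hy

/-- The quotient map onto `R^r`. -/
def toR (r : ℕ) (G : Graph V E) (o : E → V) : Ext r E(G) →+* R r G o :=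
  (arnoldIdeal r G o).ringCon.mk'.comp (Ext.equiv r E(G)).symm.toRingHom

theorem toR_surjective : Function.Surjective (toR r G o) :=
  (RingCon.mk'_surjective _).comp (Ext.equiv r E(G)).symm.surjective

theorem toR_gen (b : E(G)) : toR r G o (Ext.gen r b) = gen r G o b := rfl

theorem toR_eq_zero_iff (hlink : ∀ b : E(G), G.IsLink b (s b) (t b))
    (hs : Odd r → ∀ b, s b = o b) (z : Ext r E(G)) :
    toR r G o z = 0 ↔ z ∈ walkIdeal r s t Set.univ ⊥ := by
  have h := mem_arnoldIdeal_iff hlink hs ((Ext.equiv r E(G)).symm z)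
  rw [RingEquiv.apply_symm_apply, TwoSidedIdeal.mem_iff] at h
  rw [← h]
  exact RingCon.eq _

theorem mem_deg_iff {k : ℤ} {x : R r G o} :
    x ∈ deg r G o k ↔ ∃ z ∈ Ext.deg r E(G) k, toR r G o z = x := by
  constructor
  · rintro ⟨z, hz, rfl⟩
    exact ⟨Ext.equiv r _ z, ⟨z, hz, rfl⟩, rfl⟩
  · rintro ⟨_, ⟨z, hz, rfl⟩, rfl⟩
    exact ⟨z, hz, rfl⟩

end Comparison

/-! ### Deletion, contraction and the exact sequence -/

section Sequence

variable {V E : Type*} {Γ : Graph V E} {α : E}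

/-- Walks need ordered ends for every `r`. For `r` odd the order is that of the orientation,
otherwise it is chosen arbitrarily. -/
theorem exists_ends (r : ℕ) (Γ : Graph V E) (o : E → V) (ho : Odd r → IsOrientation Γ o) :
    ∃ s t : E(Γ) → V, (∀ b : E(Γ), Γ.IsLink b (s b) (t b)) ∧ (Odd r → ∀ b, s b = o b) := by
  have h (b : E(Γ)) : ∃ x y, Γ.IsLink b x y ∧ (Odd r → x = o b) := by
    by_cases hr : Odd r
    · obtain ⟨y, hy⟩ := ho hr b b.2
      exact ⟨_, y, hy, fun _ => rfl⟩
    · obtain ⟨x, y, hxy⟩ := Γ.exists_isLink_of_mem_edgeSet b.2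
      exact ⟨x, y, hxy, fun h => absurd h hr⟩
  choose s t h h' using h
  exact ⟨s, t, h, fun hr b => h' b hr⟩

/-- An edge of `Γ / α` as an edge of `Γ`. -/
def ofContrEdge (b : E(contr Γ α)) : E(Γ) := ⟨b, b.2.1⟩

theorem delEdge_injective : Function.Injective (delEdge (Γ := Γ) (α := α)) :=
  fun _ _ h => Subtype.ext (congrArg (fun b : E(Γ) => (b : E)) h)

theorem ofContrEdge_injective : Function.Injective (ofContrEdge (Γ := Γ) (α := α)) :=
  fun _ _ h => Subtype.ext (congrArg (fun b : E(Γ) => (b : E)) h)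

theorem range_delEdge (hα : α ∈ E(Γ)) :
    Set.range (delEdge (Γ := Γ) (α := α)) = Set.univ \ {⟨α, hα⟩} := by
  ext b
  constructor
  · rintro ⟨b, rfl⟩
    exact ⟨trivial, fun h => b.2.2 (congrArg (fun b : E(Γ) => (b : E)) h)⟩
  · rintro ⟨-, h⟩
    exact ⟨⟨b, b.2, fun h' => h (Subtype.ext h')⟩, rfl⟩

theorem range_ofContrEdge (hα : α ∈ E(Γ)) :
    Set.range (ofContrEdge (Γ := Γ) (α := α)) = Set.univ \ {⟨α, hα⟩} := by
  rw [← range_delEdge hα]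
  ext b
  exact ⟨fun ⟨b, h⟩ => ⟨⟨b, b.2⟩, h⟩, fun ⟨b, h⟩ => ⟨⟨b, b.2⟩, h⟩⟩

/-- `Quot` imposes the equivalence relation generated by the ends of `α`; `glue` describes it
explicitly, so that contraction becomes a change of `Q`. -/
theorem glue_bot_iff {p q : V} (h : Γ.IsLink α p q) (x y : V) :
    glue ⊥ p q x y ↔ (Quot.mk _ x : ContrV Γ α) = Quot.mk _ y := by
  have hpq : (Quot.mk _ p : ContrV Γ α) = Quot.mk _ q := Quot.sound h
  constructor
  · rintro (h | ⟨h, h'⟩ | ⟨h, h'⟩)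
    · exact congrArg _ h
    · obtain rfl : x = p := h
      obtain rfl : q = y := h'
      exact hpq
    · obtain rfl : x = q := h
      obtain rfl : p = y := h'
      exact hpq.symm
  · intro hxy
    refine Setoid.eqvGen_le (s := glue ⊥ p q) (fun a b hab => ?_) (Quot.eqvGen_exact hxy)
    rcases hab.eq_and_eq_or_eq_and_eq h with ⟨rfl, rfl⟩ | ⟨rfl, rfl⟩
    · exact glue_left_right _ _ _
    · exact Setoid.symm' _ (glue_left_right _ _ _)

theorem toR_del_eq_zero_iff {r : ℕ} {o : E → V} {s t : E(Γ) → V}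
    (hlink : ∀ b : E(Γ), Γ.IsLink b (s b) (t b)) (hs : Odd r → ∀ b, s b = o b) (hα : α ∈ E(Γ))
    (z : Ext r E(del Γ α)) : toR r (del Γ α) o z = 0 ↔
      Ext.map delEdge z ∈ walkIdeal r s t (Set.univ \ {⟨α, hα⟩}) ⊥ := by
  rw [map_mem_walkIdeal_iff (s' := fun b : E(del Γ α) => s (delEdge b))
    (t' := fun b => t (delEdge b)) delEdge_injective (p := id)
    Function.surjective_id (fun _ _ => Iff.rfl) (fun _ => rfl) (fun _ => rfl) (range_delEdge hα)]
  exact toR_eq_zero_iff (G := del Γ α) (fun b => ⟨hlink (delEdge b), b.2.2⟩)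
    (fun hr b => hs hr _) z

theorem toR_contr_eq_zero_iff {r : ℕ} {o : E → V} {s t : E(Γ) → V}
    (hlink : ∀ b : E(Γ), Γ.IsLink b (s b) (t b)) (hs : Odd r → ∀ b, s b = o b) (hα : α ∈ E(Γ))
    (z : Ext r E(contr Γ α)) : toR r (contr Γ α) (contrOr Γ α o) z = 0 ↔
      Ext.map ofContrEdge z ∈ walkIdeal r s t (Set.univ \ {⟨α, hα⟩})
        (glue ⊥ (s ⟨α, hα⟩) (t ⟨α, hα⟩)) := by
  rw [map_mem_walkIdeal_iff
    (s' := fun b : E(contr Γ α) => (Quot.mk _ (s (ofContrEdge b)) : ContrV Γ α))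
    (t' := fun b => Quot.mk _ (t (ofContrEdge b))) ofContrEdge_injective (p := Quot.mk _)
    Quot.mk_surjective (glue_bot_iff (hlink ⟨α, hα⟩)) (fun _ => rfl) (fun _ => rfl)
    (range_ofContrEdge hα)]
  refine toR_eq_zero_iff (G := contr Γ α) (fun b => ?_) (fun hr b => ?_) z
  · exact Graph.IsLink.map _ (G := del Γ α) ⟨hlink (ofContrEdge b), b.2.2⟩
  · exact congrArg _ (hs hr (ofContrEdge b))

theorem exists_exact_sequence {r : ℕ} {X X₁ X₂ V A A₁ A₂ : Type*} [Ring A] [Ring A₁] [Ring A₂]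
    {s t : X → V} (hl : LooplessOn s t Set.univ ⊥) (a : X) {j₁ : X₁ → X} {j₂ : X₂ → X}
    (hj₁ : j₁.Injective) (hj₂ : j₂.Injective) (hr₁ : Set.range j₁ = Set.univ \ {a})
    (hr₂ : Set.range j₂ = Set.univ \ {a}) {π : Ext r X →+* A} {π₁ : Ext r X₁ →+* A₁}
    {π₂ : Ext r X₂ →+* A₂} (hπ : Function.Surjective π) (hπ₁ : Function.Surjective π₁)
    (kπ : ∀ z, π z = 0 ↔ z ∈ walkIdeal r s t Set.univ ⊥)
    (kπ₁ : ∀ z, π₁ z = 0 ↔ Ext.map j₁ z ∈ walkIdeal r s t (Set.univ \ {a}) ⊥)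
    (kπ₂ : ∀ z, π₂ z = 0 ↔ Ext.map j₂ z ∈ walkIdeal r s t (Set.univ \ {a}) (glue ⊥ (s a) (t a)))
    {D : ℤ → AddSubgroup A} {D₁ : ℤ → AddSubgroup A₁} {D₂ : ℤ → AddSubgroup A₂}
    (hD : ∀ k x, x ∈ D k ↔ ∃ z ∈ Ext.deg r X k, π z = x)
    (hD₁ : ∀ k x, x ∈ D₁ k ↔ ∃ z ∈ Ext.deg r X₁ k, π₁ z = x)
    (hD₂ : ∀ k x, x ∈ D₂ k ↔ ∃ z ∈ Ext.deg r X₂ k, π₂ z = x) :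
    ∃ (i : A₁ →+* A) (q : A₁ →+* A₂) (g : A →+ A₂),
      (∀ z, i (π₁ z) = π (Ext.map j₁ z)) ∧
      (∀ z, q (π₁ z) = π₂ (Ext.pull j₂ (Ext.map j₁ z))) ∧
      (∀ x y, g (i x + i y * π (Ext.gen r a)) = q y) ∧
      ∀ k : ℤ, ∃ (ik : D₁ k →+ D k) (gk : D k →+ D₂ (k - r + 1)),
        (∀ x, (ik x : A) = i x) ∧ (∀ x, (gk x : A₂) = g x) ∧
        Function.Injective ik ∧ Function.Exact ik gk ∧ Function.Surjective gk := by
  have hret₁ (z : Ext r X₁) :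
      Ext.ret (Set.univ \ {a}) (Ext.map j₁ z) = Ext.map j₁ z := by
    rw [← hr₁, ← Ext.map_pull hj₁, Ext.pull_map hj₁]
  have hret₂ (z : Ext r X₂) :
      Ext.ret (Set.univ \ {a}) (Ext.map j₂ z) = Ext.map j₂ z := by
    rw [← hr₂, ← Ext.map_pull hj₂,
      Ext.pull_map hj₂]
  have hpull₁ {z : Ext r X} (hz : Ext.ret (Set.univ \ {a}) z = z) :
      Ext.map j₁ (Ext.pull j₁ z) = z := by
    rw [Ext.map_pull hj₁, hr₁, hz]
  have hpull₂ {z : Ext r X} (hz : Ext.ret (Set.univ \ {a}) z = z) :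
      Ext.map j₂ (Ext.pull j₂ z) = z := by
    rw [Ext.map_pull hj₂, hr₂, hz]
  have huniv : (Set.univ \ {a} : Set X) = {a}ᶜ := (Set.compl_eq_univ_sdiff _).symm
  -- The three maps.
  let i := RingHom.liftOfSurjective π₁ hπ₁ ⟨π.comp (Ext.map j₁), fun z hz => by
    rw [RingHom.mem_ker] at hz ⊢
    exact (kπ _).2 (walkIdeal_mono Set.sdiff_subset le_rfl ((kπ₁ z).1 hz))⟩
  have hi (z) : i (π₁ z) = π (Ext.map j₁ z) :=
    RingHom.liftOfRightInverse_comp_apply ..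
  let q := RingHom.liftOfSurjective π₁ hπ₁
    ⟨π₂.comp ((Ext.pull j₂).comp (Ext.map j₁)), fun z hz => by
      rw [RingHom.mem_ker] at hz ⊢
      rw [RingHom.comp_apply, kπ₂, RingHom.comp_apply, hpull₂ (hret₁ z)]
      exact walkIdeal_mono subset_rfl (le_glue _ _ _) ((kπ₁ z).1 hz)⟩
  have hq (z) : q (π₁ z) = π₂ (Ext.pull j₂ (Ext.map j₁ z)) :=
    RingHom.liftOfRightInverse_comp_apply ..
  have hcoeff (z : Ext r X) : Ext.ret (Set.univ \ {a}) (Ext.coeff a z) = Ext.coeff a z := by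
    rw [huniv, Ext.ret_compl_coeff]
  let g := AddMonoidHom.liftOfSurjective π.toAddMonoidHom hπ
    ⟨π₂.toAddMonoidHom.comp ((Ext.pull j₂).toAddMonoidHom.comp (Ext.coeff a)),
      fun z hz => by
        rw [AddMonoidHom.mem_ker] at hz ⊢
        change π₂ (Ext.pull j₂ (Ext.coeff a z)) = 0
        rw [kπ₂, hpull₂ (hcoeff z)]
        exact coeff_mem_walkIdeal (hl a trivial) ((kπ z).1 hz)⟩
  have hg (z) : g (π z) = π₂ (Ext.pull j₂ (Ext.coeff a z)) :=
    AddMonoidHom.liftOfRightInverse_comp_apply ..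
  have hcm {z : Ext r X} (hz : Ext.ret (Set.univ \ {a}) z = z) :
      Ext.coeff a (z * Ext.gen r a) = z := by
    rw [Ext.coeff_mul, Ext.coeff_gen_self, mul_one, Ext.ret_gen_notMem (by simp), map_zero,
      mul_zero, add_zero, ← huniv, hz]
  have hgiq (x y) : g (i x + i y * π (Ext.gen r a)) = q y := by
    obtain ⟨x, rfl⟩ := hπ₁ x
    obtain ⟨y, rfl⟩ := hπ₁ y
    rw [hi, hi, ← map_mul, ← map_add, hg, hq, map_add, hcm (hret₁ y), Ext.coeff_eq_zero, zero_add]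
    rw [← huniv, hret₁]
  have hinj : Function.Injective i := by
    rw [injective_iff_map_eq_zero]
    intro x hx
    obtain ⟨z, rfl⟩ := hπ₁ x
    rw [hi, kπ] at hx
    exact (kπ₁ z).2 (mem_walkIdeal_of_ret hl trivial hx (hret₁ z))
  refine ⟨i, q, g, hi, hq, hgiq, fun k => ?_⟩
  have hik (x : D₁ k) : i x ∈ D k := by
    obtain ⟨x, hx⟩ := x
    obtain ⟨z, hz, rfl⟩ := (hD₁ _ _).1 hx
    exact (hD _ _).2 ⟨_, Ext.map_edge_mem_deg _ hz, (hi z).symm⟩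
  have hgk (x : D k) : g x ∈ D₂ (k - r + 1) := by
    obtain ⟨x, hx⟩ := x
    obtain ⟨z, hz, rfl⟩ := (hD _ _).1 hx
    exact (hD₂ _ _).2 ⟨_, Ext.pull_mem_deg hj₂ (Ext.coeff_mem_deg a hz),
      (hg z).symm⟩
  refine ⟨(i.toAddMonoidHom.comp (D₁ k).subtype).codRestrict _ hik,
    (g.comp (D k).subtype).codRestrict _ hgk, fun _ => rfl, fun _ => rfl, ?_, ?_, ?_⟩
  · intro x y hxy
    exact Subtype.ext (hinj (congrArg Subtype.val hxy))
  · intro y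
    constructor
    · intro hy
      replace hy : g y = 0 := congrArg Subtype.val hy
      obtain ⟨y, hy'⟩ := y
      obtain ⟨z, hz, rfl⟩ := (hD _ _).1 hy'
      change g (π z) = 0 at hy
      rw [hg, kπ₂, hpull₂ (hcoeff z)] at hy
      -- The representative `w` free of `e_α` need not be homogeneous. Its component of degree `k`
      -- serves as well, since `z` has degree `k` and the ideal is homogeneous.
      obtain ⟨w, hw, hzw⟩ := exists_sub_mem_walkIdeal (Set.mem_univ a) (Ext.ret_univ z) hy
      have hzw' := proj_mem_walkIdeal hzw k
      rw [map_sub, Ext.proj_eq_self hz] at hzw'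
      have hw' : Ext.ret (Set.univ \ {a}) (Ext.proj k w) = Ext.proj k w := by
        rw [← Ext.proj_ret, hw]
      refine ⟨⟨π₁ (Ext.pull j₁ (Ext.proj k w)), (hD₁ _ _).2
        ⟨_, Ext.pull_mem_deg hj₁ (Ext.proj_mem_deg w k), rfl⟩⟩, Subtype.ext ?_⟩
      change i (π₁ _) = π z
      rw [hi, hpull₁ hw']
      rw [← kπ, map_sub, sub_eq_zero] at hzw'
      exact hzw'.symm
    · rintro ⟨x, rfl⟩
      refine Subtype.ext ?_
      change g (i x) = 0
      simpa using hgiq x 0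
  · rintro ⟨y, hy⟩
    obtain ⟨z, hz, rfl⟩ := (hD₂ _ _).1 hy
    -- A preimage under `g` is the lift of the class multiplied by `e_α`, whose degree `r - 1` makes
    -- up for the shift.
    refine ⟨⟨π (Ext.map j₂ z * Ext.gen r a), (hD _ _).2 ⟨_, ?_, rfl⟩⟩,
      Subtype.ext ?_⟩
    · convert Ext.mul_mem_deg (Ext.map_edge_mem_deg j₂ hz) (Ext.gen_mem_deg a) using 2
      ring
    · change g (π _) = π₂ z
      rw [hg, hcm (hret₂ z), Ext.pull_map hj₂]

end Sequence

end GraphRing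

end

theorem corollary1 {V : Type*} {E : Type*} (r : ℕ) (Γ : Graph V E) [Γ.Loopless]
    (o : E → V) (ho : Odd r → GraphRing.IsOrientation Γ o) (α : E) (hα : α ∈ Graph.edgeSet Γ) :
    -- `i` is induced by the inclusion of `Γ ∖ α` in `Γ`, `q` by the map `Γ ∖ α → Γ / α`
    ∃ (i : GraphRing.R r (GraphRing.del Γ α) o →+* GraphRing.R r Γ o)
      (q : GraphRing.R r (GraphRing.del Γ α) o →+*
        GraphRing.R r (GraphRing.contr Γ α) (GraphRing.contrOr Γ α o))
      (g : GraphRing.R r Γ o →+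
        GraphRing.R r (GraphRing.contr Γ α) (GraphRing.contrOr Γ α o)),
      (∀ b, i (GraphRing.gen r (GraphRing.del Γ α) o b) =
        GraphRing.gen r Γ o (GraphRing.delEdge b)) ∧
      (∀ b, q (GraphRing.gen r (GraphRing.del Γ α) o b) =
        GraphRing.gen r (GraphRing.contr Γ α) (GraphRing.contrOr Γ α o)
          (GraphRing.contrEdge b)) ∧
      (∀ x y, g (i x + i y * GraphRing.gen r Γ o ⟨α, hα⟩) = q y) ∧
      ∀ k : ℤ,
        ∃ (ik : GraphRing.deg r (GraphRing.del Γ α) o k →+ GraphRing.deg r Γ o k)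
          (gk : GraphRing.deg r Γ o k →+
            GraphRing.deg r (GraphRing.contr Γ α) (GraphRing.contrOr Γ α o) (k - r + 1)),
          (∀ x, (ik x : GraphRing.R r Γ o) = i x) ∧
          (∀ x, (gk x : GraphRing.R r (GraphRing.contr Γ α) (GraphRing.contrOr Γ α o)) = g x) ∧
          Function.Injective ik ∧ Function.Exact ik gk ∧ Function.Surjective gk := by
  open GraphRing in
  obtain ⟨s, t, hlink, hs⟩ := exists_ends r Γ o ho
  have hl : LooplessOn s t Set.univ ⊥ := fun b _ h => (hlink b).ne h
  obtain ⟨i, q, g, hi, hq, hg, h⟩ := exists_exact_sequence hl ⟨α, hα⟩ delEdge_injective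
    ofContrEdge_injective (range_delEdge hα) (range_ofContrEdge hα)
    (toR_surjective (G := Γ) (o := o)) (toR_surjective (G := del Γ α) (o := o))
    (toR_eq_zero_iff hlink hs) (toR_del_eq_zero_iff hlink hs hα)
    (toR_contr_eq_zero_iff hlink hs hα) (fun _ _ => mem_deg_iff) (fun _ _ => mem_deg_iff)
    (fun _ _ => mem_deg_iff)
  refine ⟨i, q, g, fun b => ?_, fun b => ?_, hg, h⟩
  · rw [← toR_gen, hi, Ext.map_gen, toR_gen]
  · rw [← toR_gen, hq, Ext.map_gen]
    exact congrArg (toR r (contr Γ α) (contrOr Γ α o))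
      (Ext.pull_gen ofContrEdge_injective (contrEdge b))
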